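/- Let $V$ be a nonzero finite-dimensional complex Hilbert space, and let $\mathscr A$ be the quasi-local $C^*$-algebra of the spin chain on $\mathbb Z$ with on-site space $V$: the norm completion of the local algebras $\bigotimes_{j\in\Gamma}B(V)$, $\Gamma\subset\mathbb Z$ finite. For $X\subset\mathbb R$ let $\mathscr A_X\subset\mathscr A$ be the closed subalgebra generated by the sites in $X\cap\mathbb Z$. A $*$-automorphism $\alpha$ of $\mathscr A$ is a *locality-preserving automorphism* (LPA) if there is $f:\mathbb R_{\ge0}\to\mathbb R_{\ge0}$ with $\lim_{r\to\infty}f(r)=0$ such that, for every $r>0$, every closed interval $\Gamma\subset\mathbb R$ and every $A\in\mathscr A_\Gamma$, the distance of $\alpha(A)$ from $\mathscr A_{\{x\,:\,\mathrm{dist}(x,\Gamma)\le r\}}$ is at most $f(r)\|A\|$ (one says that $\alpha$ has $f(r)$-tails). A *quantum cellular automaton* (QCA) is a $*$-automorphism $\kappa$ with $\kappa(\mathscr A_X)\subset\mathscr A_{\{x\,:\,\mathrm{dist}(x,X)\le R\}}$ for some fixed $R$ and all $X$. If $\ell\ge R$ is a positive integer, its *GNVW index* is $\tfrac12\bigl(\log\dim(\kappa(\mathscr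 A_{[0,2\ell)})\cap\mathscr A_{[-\ell,\ell)})-\log\dim\mathscr A_{[0,\ell)}\bigr)$. The GNVW index of an LPA is the index of QCAs that converge to it pointwise in norm with uniform tails; it is *trivial* if it is $0$. For a unitary $U\in\mathscr A$ put $\mathrm{Ad}_U(A)=UAU^*$. Let $\mathcal G_{\ge0}$ (resp. $\mathcal G_{<0}$) be the group of LPAs that preserve $\mathscr A_{[0,\infty)}$ and fix $\mathscr A_{(-\infty,0)}$ pointwise (resp. preserve $\mathscr A_{(-\infty,0)}$ and fix $\mathscr A_{[0,\infty)}$ pointwise). Put $\mathcal G_+=\{\mathrm{Ad}_U\,\gamma: U\in\mathscr A\text{ unitary},\ \gamma\in\mathcal G_{\ge0}\}$ and $\mathcal G_-=\{\mathrm{Ad}_U\,\gamma: U\in\mathscr A\text{ unitary},\ \gamma\in\mathcal G_{<0}\}$. **Proposition.** Let $G$ be a group and $\alpha$ a homomorphism from $G$ to the group of LPAs such that every $\alpha(g)$ has trivial GNVW index. Let $\beta:G\to\mathcal G_+$ be any map with $\alpha(g)\beta(g)^{-1}\in\mathcal G_-$ for all $g$. Then there is a map $\mathcal V$ from $G\times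 G$ to the unitary group of $\mathscr A$ with $$\beta(g)\beta(h)\beta(gh)^{-1}=\mathrm{Ad}_{\mathcal V(g,h)}\qquad(g,h\in G).$$ For any such $(\beta,\mathcal V)$, $$\mathcal V(g_1,g_2)\,\mathcal V(g_1g_2,g_3)\,\mathcal V(g_1,g_2g_3)^{-1}\,\beta(g_1)\bigl(\mathcal V(g_2,g_3)\bigr)^{-1}=\omega(g_1,g_2,g_3)\cdot 1$$ with $\omega(g_1,g_2,g_3)\in U(1)$, and $\omega$ is a $3$-cocycle of $G$ with values in the trivial $G$-module $U(1)$. Its class $[\omega]\in H^3(G,U(1))$ is the same for all choices of $(\beta,\mathcal V)$. -/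

import Mathlib

open scoped NNReal Topology

noncomputable section

namespace SpinChain

/-! ### The quasi-local algebra of a spin chain

The on-site Hilbert space is `V = ℂ ^ d`.  For a finite `Γ ⊂ ℤ` the algebra `⨂_{j ∈ Γ} B(V)` is the
algebra of matrices indexed by the configurations `Γ → Fin d`.  All these algebras act, compatibly
with the inclusions `Γ ⊂ Γ'` and faithfully, on the Hilbert space with orthonormal basis the
configurations `ℤ → Fin d` of the whole chain.  A faithful representation of a finite-dimensional
C⋆-algebra is isometric, so the algebra of local observables (the colimit of normed ⋆-algebras) is
the union of the images, with the operator norm, and its completion is the norm closure. -/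

/-- Configurations of the whole chain. -/
abbrev Config (d : ℕ) : Type := ℤ → Fin d

/-- The Hilbert space with orthonormal basis the configurations of the chain. -/
abbrev ConfigSpace (d : ℕ) : Type := lp (fun _ : Config d => ℂ) 2

variable {d : ℕ}

/-- The restriction of a configuration to `Γ`. -/
def restrict (Γ : Finset ℤ) (σ : Config d) : Γ → Fin d := fun j => σ j

/-- The configuration that is `b` on `Γ` and `σ` off `Γ`. -/
def override (Γ : Finset ℤ) (σ : Config d) (b : Γ → Fin d) : Config d :=
  fun j => if h : j ∈ Γ then b ⟨j, h⟩ else σ j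

@[simp] lemma restrict_override (Γ : Finset ℤ) (σ : Config d) (b : Γ → Fin d) :
    restrict Γ (override Γ σ b) = b := by
  funext j; simp [restrict, override]

@[simp] lemma override_override (Γ : Finset ℤ) (σ : Config d) (b c : Γ → Fin d) :
    override Γ (override Γ σ b) c = override Γ σ c := by
  funext j; by_cases h : j ∈ Γ <;> simp [override, h]

@[simp] lemma override_restrict (Γ : Finset ℤ) (σ : Config d) :
    override Γ σ (restrict Γ σ) = σ := by
  funext j; by_cases h : j ∈ Γ <;> simp [restrict, override, h]

/-- The permutation of configurations that exchanges `a` and `b` on `Γ`. -/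
def swapConfig (Γ : Finset ℤ) (a b : Γ → Fin d) : Equiv.Perm (Config d) where
  toFun σ := override Γ σ (Equiv.swap a b (restrict Γ σ))
  invFun σ := override Γ σ (Equiv.swap a b (restrict Γ σ))
  left_inv σ := by simp
  right_inv σ := by simp

lemma swapConfig_apply (Γ : Finset ℤ) (a b : Γ → Fin d) (σ : Config d) :
    swapConfig Γ a b σ = override Γ σ (Equiv.swap a b (restrict Γ σ)) := rfl

/-- The function `σ ↦ f (σ with b on Γ)` if `σ` is `a` on `Γ`, and `0` otherwise. -/
def unitFun (Γ : Finset ℤ) (a b : Γ → Fin d) (f : Config d → ℂ) : Config d → ℂ :=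
  fun σ => if restrict Γ σ = a then f (override Γ σ b) else 0

lemma unitFun_eq_swap (Γ : Finset ℤ) (a b : Γ → Fin d) (f : Config d → ℂ) (σ : Config d) :
    unitFun Γ a b f σ = if restrict Γ σ = a then f (swapConfig Γ a b σ) else 0 := by
  unfold unitFun
  split_ifs with h
  · simp [swapConfig_apply, h]
  · rfl

lemma norm_unitFun_le (Γ : Finset ℤ) (a b : Γ → Fin d) (f : Config d → ℂ) (σ : Config d) :
    ‖unitFun Γ a b f σ‖ ^ (2 : ENNReal).toReal
      ≤ ‖f (swapConfig Γ a b σ)‖ ^ (2 : ENNReal).toReal := by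
  rw [unitFun_eq_swap]
  split_ifs
  · exact le_rfl
  · simp

lemma summable_swap (Γ : Finset ℤ) (a b : Γ → Fin d) (f : ConfigSpace d) :
    Summable fun σ => ‖f (swapConfig Γ a b σ)‖ ^ (2 : ENNReal).toReal :=
  (swapConfig Γ a b).summable_iff.mpr ((lp.memℓp f).summable (by simp))

lemma memlp_unitFun (Γ : Finset ℤ) (a b : Γ → Fin d) (f : ConfigSpace d) :
    Memℓp (unitFun Γ a b f) 2 :=
  memℓp_gen ((summable_swap Γ a b f).of_nonneg_of_le (fun _ => by positivity)
    (norm_unitFun_le Γ a b f))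

/-- The matrix unit `e_{ab}` of `⨂_{j ∈ Γ} B(V)`, acting on the chain. -/
def matrixUnit (Γ : Finset ℤ) (a b : Γ → Fin d) : ConfigSpace d →L[ℂ] ConfigSpace d :=
  LinearMap.mkContinuous
    { toFun := fun f => ⟨unitFun Γ a b f, memlp_unitFun Γ a b f⟩
      map_add' := fun f g => by
        ext σ
        change unitFun Γ a b (fun τ => f τ + g τ) σ = unitFun Γ a b f σ + unitFun Γ a b g σ
        by_cases h : restrict Γ σ = a <;> simp [unitFun, h]
      map_smul' := fun c f => by
        ext σ; by_cases h : restrict Γ σ = a <;> simp [unitFun, h] }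
    1 (fun f => by
      rw [one_mul]
      refine lp.norm_le_of_tsum_le (by simp) (norm_nonneg _) ?_
      rw [lp.norm_rpow_eq_tsum (by simp) f,
        ← (swapConfig Γ a b).tsum_eq fun σ => ‖f σ‖ ^ (2 : ENNReal).toReal]
      exact Summable.tsum_le_tsum (norm_unitFun_le Γ a b f)
        ((summable_swap Γ a b f).of_nonneg_of_le (fun _ => by positivity)
          (norm_unitFun_le Γ a b f)) (summable_swap Γ a b f))

lemma matrixUnit_apply (Γ : Finset ℤ) (a b : Γ → Fin d) (f : ConfigSpace d) (σ : Config d) :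
    matrixUnit Γ a b f σ = if restrict Γ σ = a then f (override Γ σ b) else 0 := rfl

lemma adjoint_matrixUnit (Γ : Finset ℤ) (a b : Γ → Fin d) :
    star (matrixUnit Γ a b) = matrixUnit Γ b a := by
  rw [ContinuousLinearMap.star_eq_adjoint]
  symm
  rw [ContinuousLinearMap.eq_adjoint_iff]
  intro f g
  rw [lp.inner_eq_tsum, lp.inner_eq_tsum, ← (swapConfig Γ a b).tsum_eq]
  refine tsum_congr fun σ => ?_
  rw [matrixUnit_apply, matrixUnit_apply, swapConfig_apply]
  by_cases h : restrict Γ σ = a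
  · subst h; simp
  · have : Equiv.swap a b (restrict Γ σ) ≠ b := by
      rw [Ne, Equiv.swap_apply_eq_iff, Equiv.swap_apply_right]; exact h
    simp [h, this]

/-- The action on the chain of a matrix over the configurations of `Γ`, as an operator. -/
def localOp (Γ : Finset ℤ) (M : Matrix (Γ → Fin d) (Γ → Fin d) ℂ) :
    ConfigSpace d →L[ℂ] ConfigSpace d :=
  ∑ a, ∑ b, M a b • matrixUnit Γ a b

lemma localOp_apply (Γ : Finset ℤ) (M : Matrix (Γ → Fin d) (Γ → Fin d) ℂ) (f : ConfigSpace d)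
    (σ : Config d) :
    localOp Γ M f σ = ∑ b, M (restrict Γ σ) b * f (override Γ σ b) := by
  simp only [localOp, sum_apply, lp.coeFn_sum, Finset.sum_apply,
    smul_apply, lp.coeFn_smul, Pi.smul_apply, matrixUnit_apply, smul_eq_mul]
  rw [Finset.sum_comm]
  refine Finset.sum_congr rfl fun b _ => ?_
  rw [Finset.sum_eq_single (restrict Γ σ)]
  · simp
  · intro a _ ha; simp [Ne.symm ha]
  · simp

/-- The representation on the chain of the algebra `⨂_{j ∈ Γ} B(V)` of observables on `Γ`. -/
def localRep (Γ : Finset ℤ) :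
    Matrix (Γ → Fin d) (Γ → Fin d) ℂ →⋆ₐ[ℂ] (ConfigSpace d →L[ℂ] ConfigSpace d) where
  toFun := localOp Γ
  map_one' := by
    ext f σ
    rw [localOp_apply]
    simp [Matrix.one_apply]
  map_mul' M N := by
    ext f σ
    change localOp Γ (M * N) f σ = localOp Γ M (localOp Γ N f) σ
    rw [localOp_apply, localOp_apply]
    simp only [localOp_apply, restrict_override, override_override, Matrix.mul_apply,
      Finset.sum_mul, Finset.mul_sum]
    rw [Finset.sum_comm]
    simp only [mul_assoc]
  map_zero' := by simp [localOp]
  map_add' M N := by simp [localOp, add_smul, Finset.sum_add_distrib]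
  commutes' c := by
    ext f σ
    rw [localOp_apply]
    simp [Matrix.algebraMap_matrix_apply, Algebra.algebraMap_eq_smul_one]
  map_star' M := by
    simp only [localOp, star_sum, star_smul, adjoint_matrixUnit, Matrix.star_apply]
    rw [Finset.sum_comm]

/-- The representations of the local algebras are faithful. -/
lemma localRep_injective [NeZero d] (Γ : Finset ℤ) :
    Function.Injective (localRep (d := d) Γ) := by
  classical
  intro M N h
  ext a b
  have key : ∀ M : Matrix (Γ → Fin d) (Γ → Fin d) ℂ,
      localOp Γ M (lp.single 2 (override Γ (fun _ => 0) b) 1) (override Γ (fun _ => 0) a)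
        = M a b := by
    intro M
    rw [localOp_apply, Finset.sum_eq_single b]
    · simp
    · intro c _ hc
      have : override Γ (fun _ => (0 : Fin d)) c ≠ override Γ (fun _ => 0) b := fun h =>
        hc (by simpa using congrArg (restrict Γ) h)
      simp [this]
    · simp
  rw [← key M, ← key N]
  exact congrArg (fun T : ConfigSpace d →L[ℂ] ConfigSpace d =>
    T (lp.single 2 (override Γ (fun _ => 0) b) 1) (override Γ (fun _ => 0) a)) h

/-- The canonical embedding `M ↦ M ⊗ 1` of the observables on `Γ` into those on `Γ'`, `Γ ⊆ Γ'`. -/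
def extendMatrix {Γ Γ' : Finset ℤ} (hΓ : Γ ⊆ Γ') (M : Matrix (Γ → Fin d) (Γ → Fin d) ℂ) :
    Matrix (Γ' → Fin d) (Γ' → Fin d) ℂ :=
  Matrix.of fun a b =>
    if ∀ j : Γ', (j : ℤ) ∉ Γ → a j = b j then
      M (fun j => a ⟨j, hΓ j.2⟩) (fun j => b ⟨j, hΓ j.2⟩)
    else 0

/-- The representations of the local algebras are compatible with the canonical embeddings. -/
lemma localRep_extendMatrix {Γ Γ' : Finset ℤ} (hΓ : Γ ⊆ Γ')
    (M : Matrix (Γ → Fin d) (Γ → Fin d) ℂ) :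
    localRep Γ' (extendMatrix hΓ M) = localRep Γ M := by
  ext f σ
  change localOp Γ' _ f σ = localOp Γ M f σ
  rw [localOp_apply, localOp_apply]
  simp only [extendMatrix, Matrix.of_apply, ite_mul, zero_mul]
  rw [← Finset.sum_filter]
  refine Finset.sum_nbij' (fun b j => b ⟨j, hΓ j.2⟩) (fun b => restrict Γ' (override Γ σ b))
    (by simp) ?_ ?_ ?_ ?_
  · intro b _
    simp only [Finset.mem_filter, Finset.mem_univ, true_and]
    intro j hj
    simp [restrict, override, hj]
  · intro b hb
    simp only [Finset.mem_filter, Finset.mem_univ, true_and] at hb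
    funext j
    by_cases hj : (j : ℤ) ∈ Γ
    · simp [restrict, override, hj]
    · simpa [restrict, override, hj] using hb j hj
  · intro b _
    funext j
    simp [restrict, override]
  · intro b hb
    simp only [Finset.mem_filter, Finset.mem_univ, true_and] at hb
    have : override Γ' σ b = override Γ σ (fun j => b ⟨j, hΓ j.2⟩) := by
      funext j
      by_cases hj : j ∈ Γ
      · simp [override, hj, hΓ hj]
      · by_cases hj' : j ∈ Γ'
        · have := hb ⟨j, hj'⟩ hj
          simp [override, hj, hj', ← this, restrict]
        · simp [override, hj, hj']
    rw [this]
    rfl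

variable (d) in
/-- The operators on the chain that are local observables supported on `X ⊂ ℝ`. -/
def localAlgebra (X : Set ℝ) : StarSubalgebra ℂ (ConfigSpace d →L[ℂ] ConfigSpace d) :=
  ⨆ Γ : {Γ : Finset ℤ // ∀ j ∈ Γ, (j : ℝ) ∈ X}, (localRep Γ.1).range

variable (d) in
/-- The C⋆-algebra of quasi-local observables of the spin chain with on-site space `ℂ ^ d`. -/
abbrev QuasiLocal : Type :=
  (localAlgebra d Set.univ).topologicalClosure

variable (d) in
/-- The C⋆-algebra of quasi-local observables on `X ⊂ ℝ`, inside the quasi-local algebra. -/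
def quasiLocalOn (X : Set ℝ) : StarSubalgebra ℂ (QuasiLocal d) :=
  (localAlgebra d X).topologicalClosure.comap (localAlgebra d Set.univ).topologicalClosure.subtype

variable (d) in
/-- The group of ⋆-automorphisms of the quasi-local algebra, under composition. -/
abbrev ChainAut : Type := QuasiLocal d ≃⋆ₐ[ℂ] QuasiLocal d

/-- Conjugation `A ↦ U A U⋆` by a unitary quasi-local observable. -/
def Ad (U : unitary (QuasiLocal d)) : ChainAut d := Unitary.conjStarAlgAut ℂ (QuasiLocal d) U

/-! ### Locality-preserving automorphisms -/

/-- The set of points at distance at most `r` from a point of `X`. -/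
def fattening (X : Set ℝ) (r : ℝ) : Set ℝ := {x | ∃ y ∈ X, |x - y| ≤ r}

/-- `α` has `f(r)`-tails: for every closed interval `Γ` and `r > 0`, every `A` in the algebra of `Γ`
is mapped to within `f(r) ‖A‖` of the algebra of the `r`-fattening of `Γ`. -/
def HasTails (α : ChainAut d) (f : ℝ≥0 → ℝ≥0) : Prop :=
  ∀ r : ℝ≥0, 0 < r → ∀ Γ : Set ℝ, Γ.OrdConnected → IsClosed Γ → ∀ A ∈ quasiLocalOn d Γ,
    Metric.infDist (α A) (quasiLocalOn d (fattening Γ r) : Set (QuasiLocal d)) ≤ f r * ‖A‖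

/-- Locality-preserving automorphisms (LPAs). -/
def IsLPA (α : ChainAut d) : Prop :=
  ∃ f : ℝ≥0 → ℝ≥0, Filter.Tendsto f Filter.atTop (𝓝 0) ∧ HasTails α f

/-- LPAs that preserve the algebra of the right half-chain and fix that of the left one. -/
def IsRightLPA (α : ChainAut d) : Prop :=
  IsLPA α ∧ α '' (quasiLocalOn d (Set.Ici 0)) = quasiLocalOn d (Set.Ici 0) ∧
    ∀ A ∈ quasiLocalOn d (Set.Iio 0), α A = A

/-- LPAs that preserve the algebra of the left half-chain and fix that of the right one. -/
def IsLeftLPA (α : ChainAut d) : Prop :=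
  IsLPA α ∧ α '' (quasiLocalOn d (Set.Iio 0)) = quasiLocalOn d (Set.Iio 0) ∧
    ∀ A ∈ quasiLocalOn d (Set.Ici 0), α A = A

/-- The products of an inner automorphism and an LPA of the right half-chain. -/
def rightLPA (d : ℕ) : Set (ChainAut d) := {γ | ∃ U δ, IsRightLPA δ ∧ γ = Ad U * δ}

/-- The products of an inner automorphism and an LPA of the left half-chain. -/
def leftLPA (d : ℕ) : Set (ChainAut d) := {γ | ∃ U δ, IsLeftLPA δ ∧ γ = Ad U * δ}

/-! ### The GNVW index -/

/-- `α` is a quantum cellular automaton of radius at most `R`. -/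
def IsQCAOfRadius (α : ChainAut d) (R : ℝ) : Prop :=
  ∀ X : Set ℝ, ∀ A ∈ quasiLocalOn d X, α A ∈ quasiLocalOn d (fattening X R)

/-- The GNVW index of a quantum cellular automaton of radius at most `ℓ`.  Group the sites into
blocks `B_k = [k ℓ, (k + 1) ℓ)`, for which `α` is of nearest-neighbour type; the index is
`(log dim L - log dim A(B_0)) / 2` with `L = α(A(B_0 ∪ B_1)) ∩ A(B_{-1} ∪ B_0)`. -/
def qcaIndex (α : ChainAut d) (ℓ : ℕ) : ℝ :=
  (Real.log (Module.finrank ℂ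
      ((((quasiLocalOn d (Set.Ico 0 (2 * ℓ))).map
        α.toStarAlgHom ⊓
        quasiLocalOn d (Set.Ico (-ℓ) ℓ) : StarSubalgebra ℂ (QuasiLocal d)))))
    - Real.log (Module.finrank ℂ (quasiLocalOn d (Set.Ico 0 ℓ)))) / 2

/-- The GNVW index of the LPA `α` is `q`: `α` is the pointwise limit of quantum cellular automata
with uniform tails and index `q`.  (Every LPA is such a limit, and the index is continuous along such
sequences, so this is the extension of the index from quantum cellular automata to LPAs.) -/
def HasGNVWIndex (α : ChainAut d) (q : ℝ) : Prop :=
  ∃ (f : ℝ≥0 → ℝ≥0) (κ : ℕ → ChainAut d), Filter.Tendsto f Filter.atTop (𝓝 0) ∧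
    (∀ n, HasTails (κ n) f ∧ ∃ ℓ : ℕ, 0 < ℓ ∧ IsQCAOfRadius (κ n) ℓ ∧ qcaIndex (κ n) ℓ = q) ∧
    ∀ A, Filter.Tendsto (fun n => κ n A) Filter.atTop (𝓝 (α A))

/-! ### The anomaly cocycle -/

section Anomaly

universe u

variable {G : Type u} [Group G]

/-- `β` restricts the action `α` to the right half-chain. -/
def IsHalfChainRestriction (α : G →* ChainAut d) (β : G → ChainAut d) : Prop :=
  ∀ g, β g ∈ rightLPA d ∧ α g * (β g)⁻¹ ∈ leftLPA d

/-- The defect of `β` from being a homomorphism is conjugation by `V`. -/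
def IsDefect (β : G → ChainAut d) (V : G → G → unitary (QuasiLocal d)) : Prop :=
  ∀ g h, β g * β h * (β (g * h))⁻¹ = Ad (V g h)

/-- `V(g₁,g₂) V(g₁g₂,g₃) V(g₁,g₂g₃)⁻¹ (β(g₁)(V(g₂,g₃)))⁻¹`, with `U⋆ = U⁻¹` for unitaries. -/
def anomalyOp (β : G → ChainAut d) (V : G → G → unitary (QuasiLocal d)) (g₁ g₂ g₃ : G) :
    QuasiLocal d :=
  (V g₁ g₂ : QuasiLocal d) * V (g₁ * g₂) g₃ * star (V g₁ (g₂ * g₃) : QuasiLocal d) *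
    star (β g₁ (V g₂ g₃))

variable (G) in
/-- `U(1)` with trivial action of `G`, written additively.  The coefficients `ℤ` and `U(1)` are
lifted to the universe of `G`, as group cohomology in Mathlib requires. -/
abbrev trivialU1 : Rep.{u} (ULift.{u} ℤ) G :=
  Rep.trivial (ULift.{u} ℤ) G (ULift.{u} (Additive Circle))

/-- The element of `U(1)`, as a complex number, that an element of `trivialU1 G` stands for. -/
def toPhase (x : trivialU1 G) : ℂ := ((Additive.toMul (ULift.down x) : Circle) : ℂ)

end Anomaly

end SpinChain
end

open scoped NNReal Topology

noncomputable section

/-! ### The obstruction cocycle of a crossed module -/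

/-! The anomaly is the Eilenberg–Mac Lane obstruction of a homomorphism into outer automorphisms.
The unitaries act by conjugation on the quasi-local algebra, and `Ad` from unitaries to
automorphisms is a crossed module. Its kernel is `U(1)`, because the centre of the algebra is
trivial (`exists_eq_smul_one`).

Write `α g = η g * β g`, where up to inner automorphisms `β g` fixes the left half-chain and `η g`
the right one. Automorphisms fixing complementary regions commute, so modulo inner automorphisms `β
g` commutes with `η k`. Since `α` is a homomorphism, the defect of `β` is then, modulo inner ones, a
product of `η`'s and their inverses. Thus it fixes the left half up to inner automorphisms and also
the right half, and such an automorphism is inner (`mem_inner_of_mem_sup`). The same argument shows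
that two choices of `β` differ by inner automorphisms.

The analytic core is `exists_conjStarAlgAut_eq`: if `Ad X = δ * ε`, with `δ` and `ε` fixing
complementary regions, then slicing `X` over the region fixed by `δ` yields an intertwiner, which
after rescaling is a unitary implementing `δ`. The slice maps are limits of one-site slices and
exist for any C⋆-algebra with the matrix units of a chain (`MatrixUnits`).

What remains is algebra in the crossed module: the obstruction is a cocycle, and changing `β` by a
boundary and `V` by a central factor changes it by a coboundary. -/

/-- A crossed module `∂ : N → K` together with an identification `ι` of its kernel with an abelian
group `Z` on which `K` acts trivially. -/
structure TrivialKernelCrossedModule (N K Z : Type*) [Group N] [Group K] [CommGroup Z] where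
  /-- the boundary map -/
  bd : N →* K
  /-- the action of `K` on `N` -/
  act : K →* MulAut N
  /-- the inclusion of the kernel -/
  ι : Z →* N
  bd_act : ∀ k n, bd (act k n) = k * bd n * k⁻¹
  act_bd : ∀ m n, act (bd m) n = m * n * m⁻¹
  ι_injective : Function.Injective ι
  exists_of_bd_eq_one : ∀ n, bd n = 1 → ∃ z, n = ι z
  bd_ι : ∀ z, bd (ι z) = 1
  act_ι : ∀ k z, act k (ι z) = ι z

namespace TrivialKernelCrossedModule

variable {N K Z G : Type*} [Group N] [Group K] [CommGroup Z] [Group G]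
  (C : TrivialKernelCrossedModule N K Z)

lemma commute_ι (z : Z) (n : N) : Commute (C.ι z) n := by
  have h := C.act_bd (C.ι z) n
  rw [C.bd_ι, map_one, MulAut.one_apply] at h
  exact (eq_mul_inv_iff_mul_eq.mp h).symm

/-- `V` measures the failure of `β` to be a homomorphism. -/
def IsLift (β : G → K) (V : G → G → N) : Prop :=
  ∀ g h, β g * β h * (β (g * h))⁻¹ = C.bd (V g h)

/-- `w` measures the failure of `V` to be a 2-cocycle. -/
def IsObstruction (β : G → K) (V : G → G → N) (w : G → G → G → Z) : Prop :=
  ∀ a b c, V a b * V (a * b) c = C.ι (w a b c) * (C.act (β a) (V b c) * V a (b * c))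

variable {C} {β β' : G → K} {V V' : G → G → N} {w w' : G → G → G → Z}

lemma IsLift.mul_eq (h : C.IsLift β V) (a b : G) : β a * β b = C.bd (V a b) * β (a * b) := by
  rw [← h a b]; group

/-- The Peiffer identity `act_bd` turns the action of the boundary of `V a b` into conjugation by `V
a b`. -/
lemma IsLift.act_act (h : C.IsLift β V) (a b : G) (n : N) :
    C.act (β a) (C.act (β b) n) * V a b = V a b * C.act (β (a * b)) n := by
  rw [← MulAut.mul_apply, ← map_mul, h.mul_eq, map_mul, MulAut.mul_apply, C.act_bd]
  group

/-- Both bracketings have boundary `β a * β b * β c * (β (a * b * c))⁻¹`, so they differ by an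
element of the kernel. -/
lemma IsLift.exists_isObstruction (h : C.IsLift β V) : ∃ w, C.IsObstruction β V w := by
  have key : ∀ a b c, ∃ z,
      V a b * V (a * b) c * (C.act (β a) (V b c) * V a (b * c))⁻¹ = C.ι z := fun a b c => by
    apply C.exists_of_bd_eq_one
    rw [map_mul, map_mul, map_inv, map_mul, C.bd_act, ← h, ← h, ← h, ← h, mul_assoc a b c]
    group
  choose w hw using key
  exact ⟨w, fun a b c => by rw [← hw, inv_mul_cancel_right]⟩

/-- Evaluate `V a b * V (a * b) c * V (a * b * c) d` in two ways. Starting from the left takes three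
obstruction moves, one of them inside `act (β a)`; starting from the right takes two, with `act_act`
between them. The noncentral parts agree and cancel. -/
lemma IsObstruction.cocycle (hw : C.IsObstruction β V w) (h : C.IsLift β V) (a b c d : G) :
    w a b c * w a (b * c) d * w b c d = w (a * b) c d * w a b (c * d) := by
  apply C.ι_injective
  have h₁ : V a b * V (a * b) c * V (a * b * c) d =
      C.ι (w a b c * w a (b * c) d * w b c d) *
        (C.act (β a) (C.act (β b) (V c d)) * C.act (β a) (V b (c * d)) * V a (b * (c * d))) := by
    have h₂ := hw a (b * c) d
    have h₃ := congrArg (C.act (β a)) (hw b c d)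
    simp only [map_mul, C.act_ι] at h₃
    rw [hw, mul_assoc, mul_assoc, mul_assoc a b c, h₂, ← mul_assoc (C.act (β a) (V b c)),
      ← (C.commute_ι _ _).eq, mul_assoc (C.ι (w a (b * c) d)), ← mul_assoc (C.act (β a) (V b c)),
      h₃, mul_assoc b c d]
    simp only [map_mul, mul_assoc]
  have h₂ : V a b * V (a * b) c * V (a * b * c) d =
      C.ι (w (a * b) c d * w a b (c * d)) *
        (C.act (β a) (C.act (β b) (V c d)) * C.act (β a) (V b (c * d)) * V a (b * (c * d))) := by
    rw [mul_assoc, hw, ← mul_assoc, ← (C.commute_ι _ _).eq, mul_assoc, ← mul_assoc (V a b),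
      ← h.act_act, mul_assoc _ (V a b), hw, ← mul_assoc _ (C.ι _), ← (C.commute_ι _ _).eq]
    simp only [map_mul, mul_assoc]
  exact mul_right_cancel (h₁.symm.trans h₂)

/-- The change of the lift under a change of `β` by a boundary. -/
lemma IsLift.twist (h : C.IsLift β V) {W : G → N} (hβ : ∀ g, β' g = C.bd (W g) * β g) :
    C.IsLift β' fun a b => W a * C.act (β a) (W b) * V a b * (W (a * b))⁻¹ := by
  intro a b
  simp only [map_mul, map_inv, C.bd_act, hβ, ← h a b]
  group

/-- With the twisted `V` of `IsLift.twist` the obstruction does not change at all: the factors `W`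
telescope and the central factor passes through them. -/
lemma IsObstruction.twist (hw : C.IsObstruction β V w) (h : C.IsLift β V) {W : G → N}
    (hβ : ∀ g, β' g = C.bd (W g) * β g) :
    C.IsObstruction β' (fun a b => W a * C.act (β a) (W b) * V a b * (W (a * b))⁻¹) w := by
  intro a b c
  have h₁ := h.act_act a b (W c)
  have h₂ := hw a b c
  simp only [hβ, map_mul, MulAut.mul_apply, C.act_bd, map_inv, mul_assoc, inv_mul_cancel_left]
  simp only [← mul_assoc (V a b) (C.act _ _), ← h₁]
  simp only [mul_assoc]
  rw [← mul_assoc (V a b) (V _ _), h₂]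
  simp only [← mul_assoc]
  rw [(C.commute_ι (w a b c) (W a)).eq]
  congr 2
  simp only [mul_assoc]
  congr 1
  rw [← mul_assoc, ← mul_assoc, ← mul_assoc, ← mul_assoc, ← (C.commute_ι _ _).eq]
  simp only [mul_assoc, mul_inv_rev, inv_inv, inv_mul_cancel_left, inv_mul_cancel, mul_one]

/-- The twist of `V` to `β'` has the boundary of `V'` and the obstruction `w`. So `V'` is this twist
times a central `m`, and `m` alone accounts for the change from `w` to `w'`. -/
lemma IsObstruction.exists_coboundary (hw : C.IsObstruction β V w) (h : C.IsLift β V)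
    (hw' : C.IsObstruction β' V' w') (h' : C.IsLift β' V')
    (hβ : ∀ g, ∃ n, β' g = C.bd n * β g) :
    ∃ m : G → G → Z, ∀ a b c,
      w' a b c * (m b c * m a (b * c)) = w a b c * (m a b * m (a * b) c) := by
  choose W hW using hβ
  have hT := h.twist hW
  have hO := hw.twist h hW
  set U : G → G → N := fun a b => W a * C.act (β a) (W b) * V a b * (W (a * b))⁻¹
  have key : ∀ a b, ∃ z, V' a b * (U a b)⁻¹ = C.ι z := fun a b =>
    C.exists_of_bd_eq_one _ (by rw [map_mul, map_inv, ← h', ← hT, mul_inv_cancel])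
  choose m hm using key
  have hm' : ∀ a b, V' a b = C.ι (m a b) * U a b := fun a b => by
    rw [← hm, inv_mul_cancel_right]
  refine ⟨m, fun a b c => ?_⟩
  apply C.ι_injective
  have e := hw' a b c
  simp only [hm', map_mul, C.act_ι] at e
  have e' := hO a b c
  have l : C.ι (m a b) * U a b * (C.ι (m (a * b) c) * U (a * b) c) =
      C.ι (w a b c * (m a b * m (a * b) c)) * (C.act (β' a) (U b c) * U a (b * c)) := by
    rw [mul_assoc, ← mul_assoc (U a b), ← (C.commute_ι _ (U a b)).eq, mul_assoc, e',
      mul_comm (w a b c)]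
    simp only [map_mul, mul_assoc]
  have r : C.ι (w' a b c) * (C.ι (m b c) * C.act (β' a) (U b c) * (C.ι (m a (b * c)) * U a (b * c)))
      = C.ι (w' a b c * (m b c * m a (b * c))) * (C.act (β' a) (U b c) * U a (b * c)) := by
    rw [mul_assoc (C.ι (m b c)), ← mul_assoc (C.act (β' a) (U b c)), ← (C.commute_ι _ (C.act _ _)).eq]
    simp only [map_mul, mul_assoc]
  exact mul_right_cancel (r.symm.trans (e.symm.trans l))

end TrivialKernelCrossedModule

/-! ### Cohomologous cocycles have the same class -/

namespace groupCohomology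

open CategoryTheory

universe u

variable {k G : Type u} [CommRing k] [Group G]

lemma π_cocyclesMk_eq {A : Rep k G} {n : ℕ} (f f' : (Fin (n + 1) → G) → A)
    (h : inhomogeneousCochains.d A (n + 1) f = 0) (h' : inhomogeneousCochains.d A (n + 1) f' = 0)
    (m : (Fin n → G) → A) (hm : inhomogeneousCochains.d A n m = f - f') :
    π A (n + 1) (cocyclesMk f h) = π A (n + 1) (cocyclesMk f' h') := by
  -- Cocycles embed into cochains, where the equality is `hm`.
  have e : cocyclesMk f h - cocyclesMk f' h' = toCocycles A n (n + 1) m := by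
    apply (ModuleCat.mono_iff_injective (iCocycles A (n + 1))).1 inferInstance
    rw [map_sub, iCocycles_mk, iCocycles_mk, ← hm]
    rw [← ConcreteCategory.comp_apply, HomologicalComplex.toCycles_i,
      inhomogeneousCochains.d_def]
  have h₀ : toCocycles A n (n + 1) ≫ π A (n + 1) = 0 :=
    HomologicalComplex.toCycles_comp_homologyπ (inhomogeneousCochains A) n (n + 1)
  rw [← sub_eq_zero, ← map_sub, e, ← ConcreteCategory.comp_apply, h₀]
  rfl

end groupCohomology

/-! ### Inhomogeneous differentials with coefficients in `U(1)` -/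

namespace SpinChain

universe u

variable {G : Type u} [Group G]

lemma trivialU1_d_three (f : (Fin 3 → G) → trivialU1 G) (a b c d : G) :
    inhomogeneousCochains.d (trivialU1 G) 3 f ![a, b, c, d] =
      f ![b, c, d] - f ![a * b, c, d] + f ![a, b * c, d] - f ![a, b, c * d] + f ![a, b, c] := by
  have h₀ : (fun i : Fin 3 => ![a, b, c, d] i.succ) = ![b, c, d] := by
    funext i; fin_cases i <;> rfl
  have h₁ : Fin.contractNth 0 (· * ·) ![a, b, c, d] = ![a * b, c, d] := by
    funext i; fin_cases i <;> rfl
  have h₂ : Fin.contractNth 1 (· * ·) ![a, b, c, d] = ![a, b * c, d] := by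
    funext i; fin_cases i <;> rfl
  have h₃ : Fin.contractNth 2 (· * ·) ![a, b, c, d] = ![a, b, c * d] := by
    funext i; fin_cases i <;> rfl
  have h₄ : Fin.contractNth 3 (· * ·) ![a, b, c, d] = ![a, b, c] := by
    funext i; fin_cases i <;> rfl
  rw [inhomogeneousCochains.d_hom_apply, h₀, Fin.sum_univ_four, h₁, h₂, h₃, h₄]
  simp [pow_succ]
  abel

lemma trivialU1_d_two (f : (Fin 2 → G) → trivialU1 G) (a b c : G) :
    inhomogeneousCochains.d (trivialU1 G) 2 f ![a, b, c] =
      f ![b, c] - f ![a * b, c] + f ![a, b * c] - f ![a, b] := by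
  have h₀ : (fun i : Fin 2 => ![a, b, c] i.succ) = ![b, c] := by
    funext i; fin_cases i <;> rfl
  have h₁ : Fin.contractNth 0 (· * ·) ![a, b, c] = ![a * b, c] := by
    funext i; fin_cases i <;> rfl
  have h₂ : Fin.contractNth 1 (· * ·) ![a, b, c] = ![a, b * c] := by
    funext i; fin_cases i <;> rfl
  have h₃ : Fin.contractNth 2 (· * ·) ![a, b, c] = ![a, b] := by
    funext i; fin_cases i <;> rfl
  rw [inhomogeneousCochains.d_hom_apply, h₀, Fin.sum_univ_three, h₁, h₂, h₃]
  simp [pow_succ]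
  abel

/-- A function of three variables with values in `U(1)`, as a 3-cochain. -/
def threeCochain (w : G → G → G → Circle) : (Fin 3 → G) → trivialU1 G :=
  fun x => ULift.up (Additive.ofMul (w (x 0) (x 1) (x 2)))

/-- A function of two variables with values in `U(1)`, as a 2-cochain. -/
def twoCochain (m : G → G → Circle) : (Fin 2 → G) → trivialU1 G :=
  fun x => ULift.up (Additive.ofMul (m (x 0) (x 1)))

lemma d_threeCochain_eq_zero {w : G → G → G → Circle}
    (hw : ∀ a b c d, w a b c * w a (b * c) d * w b c d = w (a * b) c d * w a b (c * d)) :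
    inhomogeneousCochains.d (trivialU1 G) 3 (threeCochain w) = 0 := by
  funext x
  obtain ⟨a, b, c, d, rfl⟩ : ∃ a b c d, x = ![a, b, c, d] :=
    ⟨x 0, x 1, x 2, x 3, by funext i; fin_cases i <;> rfl⟩
  rw [trivialU1_d_three]
  apply ULift.ext
  apply Additive.toMul.injective
  change w b c d / w (a * b) c d * w a (b * c) d / w a b (c * d) * w a b c = 1
  have h := hw a b c d
  rw [← mul_inv_eq_one] at h
  rw [← h]
  simp only [div_eq_mul_inv, mul_inv]
  ac_rfl

lemma d_twoCochain_eq {w w' : G → G → G → Circle} {m : G → G → Circle}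
    (h : ∀ a b c, w' a b c * (m b c * m a (b * c)) = w a b c * (m a b * m (a * b) c)) :
    inhomogeneousCochains.d (trivialU1 G) 2 (twoCochain m) = threeCochain w - threeCochain w' := by
  funext x
  obtain ⟨a, b, c, rfl⟩ : ∃ a b c, x = ![a, b, c] :=
    ⟨x 0, x 1, x 2, by funext i; fin_cases i <;> rfl⟩
  rw [trivialU1_d_two]
  apply ULift.ext
  apply Additive.toMul.injective
  change m b c / m (a * b) c * m a (b * c) / m a b = w a b c / w' a b c
  rw [eq_div_iff_mul_eq', ← mul_left_inj (m a b * m (a * b) c), ← h]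
  simp only [div_eq_mul_inv]
  rw [show m b c * (m (a * b) c)⁻¹ * m a (b * c) * (m a b)⁻¹ * w' a b c * (m a b * m (a * b) c)
    = w' a b c * (m b c * m a (b * c)) * ((m (a * b) c)⁻¹ * m (a * b) c) * ((m a b)⁻¹ * m a b) by
      ac_rfl]
  simp

end SpinChain

namespace SpinChain

/-! ### C⋆-algebras with the matrix units of a spin chain -/

/-- A system of matrix units of a spin chain in a C⋆-algebra `A`: the matrix unit of `Γ` with indices
the restrictions to `Γ` of the configurations `σ` and `τ` is `unit Γ σ τ`. -/
structure MatrixUnits (d : ℕ) [NeZero d] (A : Type*) [CStarAlgebra A] where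
  /-- the matrix units -/
  unit : Finset ℤ → Config d → Config d → A
  unit_congr : ∀ {Γ σ σ' τ τ'}, (∀ i ∈ Γ, σ i = σ' i) → (∀ i ∈ Γ, τ i = τ' i) →
    unit Γ σ τ = unit Γ σ' τ'
  unit_empty : ∀ σ τ, unit ∅ σ τ = 1
  unit_mul_of_disjoint : ∀ {Γ Γ'}, Disjoint Γ Γ' → ∀ σ τ,
    unit Γ σ τ * unit Γ' σ τ = unit (Γ ∪ Γ') σ τ
  unit_mul_same : ∀ Γ σ τ υ, unit Γ σ τ * unit Γ τ υ = unit Γ σ υ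
  unit_mul_of_ne : ∀ {Γ σ τ τ' υ} {j : ℤ}, j ∈ Γ → τ j ≠ τ' j → unit Γ σ τ * unit Γ τ' υ = 0
  star_unit : ∀ Γ σ τ, star (unit Γ σ τ) = unit Γ τ σ
  sum_unit : ∀ j, ∑ a : Fin d, unit {j} (fun _ => a) (fun _ => a) = 1
  norm_sum_unit_mul_mul_le : ∀ j T, ‖∑ a : Fin d, unit {j} (fun _ => a) (fun _ => 0) * T *
    unit {j} (fun _ => 0) (fun _ => a)‖ ≤ ‖T‖
  exists_norm_sub_lt : ∀ T {ε : ℝ}, 0 < ε →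
    ∃ Γ, ∃ T' ∈ Submodule.span ℂ (Set.range fun p : Config d × Config d => unit Γ p.1 p.2),
      ‖T - T'‖ < ε

namespace MatrixUnits

variable {d : ℕ} [NeZero d] {A : Type*} [CStarAlgebra A] (e : MatrixUnits d A)

/-- The matrix unit `e_{ab}` at the site `j`. -/
def site (j : ℤ) (a b : Fin d) : A := e.unit {j} (fun _ => a) fun _ => b

lemma site_eq (j : ℤ) (σ τ : Config d) : e.site j (σ j) (τ j) = e.unit {j} σ τ :=
  e.unit_congr (by simp) (by simp)

lemma site_mul_site (j : ℤ) (a b c : Fin d) : e.site j a b * e.site j b c = e.site j a c :=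
  e.unit_mul_same _ _ _ _

lemma site_mul_site_of_ne (j : ℤ) (a : Fin d) {b b' : Fin d} (h : b ≠ b') (c : Fin d) :
    e.site j a b * e.site j b' c = 0 :=
  e.unit_mul_of_ne (Finset.mem_singleton_self j) h

lemma star_site (j : ℤ) (a b : Fin d) : star (e.site j a b) = e.site j b a :=
  e.star_unit _ _ _

lemma unit_insert {Γ : Finset ℤ} {j : ℤ} (hj : j ∉ Γ) (σ τ : Config d) :
    e.unit (insert j Γ) σ τ = e.site j (σ j) (τ j) * e.unit Γ σ τ := by
  rw [site_eq, e.unit_mul_of_disjoint (Finset.disjoint_singleton_left.mpr hj), Finset.insert_eq]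

/-- The observables supported on the finite set `Γ`. -/
def localOn (Γ : Finset ℤ) : Submodule ℂ A :=
  Submodule.span ℂ (Set.range fun p : Config d × Config d => e.unit Γ p.1 p.2)

/-- The quasi-local observables supported on `S`. -/
def quasiOn (S : Set ℤ) : Set A := closure (⋃ Γ : {Γ : Finset ℤ // ∀ j ∈ Γ, j ∈ S}, e.localOn Γ.1)

variable {e}

lemma unit_mem_localOn (Γ : Finset ℤ) (σ τ : Config d) : e.unit Γ σ τ ∈ e.localOn Γ :=
  Submodule.subset_span ⟨(σ, τ), rfl⟩

lemma localOn_le {Γ : Finset ℤ} {p : Submodule ℂ A} (h : ∀ σ τ, e.unit Γ σ τ ∈ p) :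
    e.localOn Γ ≤ p :=
  Submodule.span_le.mpr (by rintro _ ⟨⟨σ, τ⟩, rfl⟩; exact h σ τ)

lemma mem_quasiOn_of_mem_localOn {S : Set ℤ} {Γ : Finset ℤ} (h : ∀ j ∈ Γ, j ∈ S) {T : A}
    (hT : T ∈ e.localOn Γ) : T ∈ e.quasiOn S :=
  subset_closure (Set.mem_iUnion.mpr ⟨⟨Γ, h⟩, hT⟩)

lemma quasiOn_subset {S : Set ℤ} {C : Set A} (hC : IsClosed C)
    (h : ∀ Γ : Finset ℤ, (∀ j ∈ Γ, j ∈ S) → (e.localOn Γ : Set A) ⊆ C) : e.quasiOn S ⊆ C :=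
  closure_minimal (Set.iUnion_subset fun Γ => h Γ.1 Γ.2) hC

variable (e) in
lemma mem_quasiOn_univ (T : A) : T ∈ e.quasiOn Set.univ := by
  refine Metric.mem_closure_iff.mpr fun ε hε => ?_
  obtain ⟨Γ, T', hT', h⟩ := e.exists_norm_sub_lt T hε
  exact ⟨T', Set.mem_iUnion.mpr ⟨⟨Γ, by simp⟩, hT'⟩, by rwa [dist_eq_norm]⟩

/-- Two continuous linear maps that agree on the matrix units are equal. -/
lemma clm_ext {B : Type*} [NormedAddCommGroup B] [NormedSpace ℂ B] {S : Set ℤ} {φ ψ : A →L[ℂ] B}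
    (h : ∀ Γ : Finset ℤ, (∀ j ∈ Γ, j ∈ S) → ∀ σ τ, φ (e.unit Γ σ τ) = ψ (e.unit Γ σ τ)) {T : A}
    (hT : T ∈ e.quasiOn S) : φ T = ψ T :=
  quasiOn_subset (C := {T | φ T = ψ T}) (isClosed_eq φ.continuous ψ.continuous)
    (fun Γ hΓ _ hT' => localOn_le (p := LinearMap.eqLocus φ.toLinearMap ψ.toLinearMap)
      (fun σ τ => h Γ hΓ σ τ) hT') hT

/-! ### Commutants -/

variable (e) in
/-- `T` commutes with the observables at the site `j`. -/
def CommutesAt (j : ℤ) (T : A) : Prop := ∀ a b, Commute (e.site j a b) T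

lemma CommutesAt.star {j : ℤ} {T : A} (h : e.CommutesAt j T) : e.CommutesAt j (star T) :=
  fun a b => by
    rw [← star_site]
    exact (h b a).star_star

lemma CommutesAt.mul {j : ℤ} {S T : A} (hS : e.CommutesAt j S) (hT : e.CommutesAt j T) :
    e.CommutesAt j (S * T) := fun a b => (hS a b).mul_right (hT a b)

lemma isClosed_commutesAt (j : ℤ) : IsClosed {T : A | e.CommutesAt j T} := by
  have : {T : A | e.CommutesAt j T} = ⋂ a, ⋂ b, {T | e.site j a b * T = T * e.site j a b} := by
    ext T; simp [CommutesAt, Commute, SemiconjBy]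
  rw [this]
  exact isClosed_iInter fun a => isClosed_iInter fun b => isClosed_eq (by fun_prop) (by fun_prop)

lemma commutesAt_unit {Γ : Finset ℤ} {j : ℤ} (hj : j ∉ Γ) (σ τ : Config d) :
    e.CommutesAt j (e.unit Γ σ τ) := by
  intro a b
  -- Changing `σ` and `τ` at `j`, outside `Γ`, makes both factors matrix units of one pair of
  -- configurations, so both orders give the unit of the union.
  let σ' : Config d := fun i => if i = j then a else σ i
  let τ' : Config d := fun i => if i = j then b else τ i
  have h₁ : e.site j a b = e.unit {j} σ' τ' := e.unit_congr (by simp [σ']) (by simp [τ'])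
  have h₂ : ∀ i ∈ Γ, i ≠ j := fun i hi h => hj (h ▸ hi)
  have h₃ : e.unit Γ σ τ = e.unit Γ σ' τ' :=
    e.unit_congr (fun i hi => by simp [σ', h₂ i hi]) (fun i hi => by simp [τ', h₂ i hi])
  have hd : Disjoint {j} Γ := Finset.disjoint_singleton_left.mpr hj
  change _ * _ = _ * _
  rw [h₁, h₃, e.unit_mul_of_disjoint hd, e.unit_mul_of_disjoint hd.symm, Finset.union_comm]

lemma commutesAt_site {i j : ℤ} (h : j ≠ i) (a b : Fin d) : e.CommutesAt j (e.site i a b) :=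
  commutesAt_unit (by simpa using h) _ _

lemma commutesAt_of_mem_localOn {Γ : Finset ℤ} {j : ℤ} (hj : j ∉ Γ) {T : A}
    (hT : T ∈ e.localOn Γ) : e.CommutesAt j T := fun a b =>
  ((Subalgebra.mem_centralizer_iff ℂ (s := {e.site j a b})).mp
    (localOn_le (p := Subalgebra.toSubmodule (Subalgebra.centralizer ℂ {e.site j a b}))
      (fun σ τ => (Subalgebra.mem_centralizer_iff ℂ).mpr
        (by rintro _ rfl; exact commutesAt_unit hj σ τ a b)) hT)) _ rfl

lemma commutesAt_of_mem_quasiOn {S : Set ℤ} {j : ℤ} (hj : j ∉ S) {T : A} (hT : T ∈ e.quasiOn S) :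
    e.CommutesAt j T :=
  quasiOn_subset (isClosed_commutesAt j)
    (fun _ hΓ _ hT' => commutesAt_of_mem_localOn (fun h => hj (hΓ j h)) hT') hT

lemma commute_unit {Γ : Finset ℤ} {T : A} (h : ∀ j ∈ Γ, e.CommutesAt j T) (σ τ : Config d) :
    Commute (e.unit Γ σ τ) T := by
  induction Γ using Finset.induction_on with
  | empty => rw [e.unit_empty]; exact Commute.one_left T
  | insert j Γ hj ih =>
    rw [unit_insert _ hj]
    exact (h j (Finset.mem_insert_self _ _) _ _).mul_left
      (ih fun i hi => h i (Finset.mem_insert_of_mem hi))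

/-! ### Slice maps -/

variable (e) in
/-- The slice map of the site `j` by a vector state. -/
def siteSlice (j : ℤ) : A →L[ℂ] A :=
  ∑ b : Fin d, ContinuousLinearMap.mulLeftRight ℂ A (e.site j b 0) (e.site j 0 b)

lemma siteSlice_apply (j : ℤ) (T : A) :
    e.siteSlice j T = ∑ b : Fin d, e.site j b 0 * T * e.site j 0 b := by
  simp [siteSlice, sum_apply]

lemma norm_siteSlice_le (j : ℤ) (T : A) : ‖e.siteSlice j T‖ ≤ ‖T‖ := by
  rw [siteSlice_apply]
  exact e.norm_sum_unit_mul_mul_le j T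

lemma siteSlice_eq_self {j : ℤ} {T : A} (h : e.CommutesAt j T) : e.siteSlice j T = T := by
  rw [siteSlice_apply]
  conv_rhs => rw [← one_mul T, ← e.sum_unit j, Finset.sum_mul]
  refine Finset.sum_congr rfl fun b _ => ?_
  rw [mul_assoc, ← (h 0 b).eq, ← mul_assoc, site_mul_site]
  rfl

/-- With `siteSlice_mul_right`: the slice map is a bimodule map over the commutant of the site. -/
lemma siteSlice_mul_left {j : ℤ} {S : A} (h : e.CommutesAt j S) (T : A) :
    e.siteSlice j (S * T) = S * e.siteSlice j T := by
  simp only [siteSlice_apply, Finset.mul_sum, mul_assoc]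
  refine Finset.sum_congr rfl fun b _ => ?_
  rw [← mul_assoc, (h b 0).eq, mul_assoc]

lemma siteSlice_mul_right {j : ℤ} {S : A} (h : e.CommutesAt j S) (T : A) :
    e.siteSlice j (T * S) = e.siteSlice j T * S := by
  simp only [siteSlice_apply, Finset.sum_mul, mul_assoc]
  refine Finset.sum_congr rfl fun b _ => ?_
  rw [(h 0 b).eq]

lemma siteSlice_site (j : ℤ) (a b : Fin d) :
    e.siteSlice j (e.site j a b) = if a = 0 ∧ b = 0 then 1 else 0 := by
  rw [siteSlice_apply]
  split_ifs with h
  · rw [h.1, h.2, ← e.sum_unit j]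
    refine Finset.sum_congr rfl fun c _ => ?_
    rw [site_mul_site, site_mul_site]
    rfl
  · refine Finset.sum_eq_zero fun c _ => ?_
    by_cases ha : a = 0
    · rw [mul_assoc, site_mul_site_of_ne e j a (fun hb => h ⟨ha, hb⟩), mul_zero]
    · rw [site_mul_site_of_ne e j c (Ne.symm ha), zero_mul]

lemma siteSlice_mem_localOn {Γ : Finset ℤ} (j : ℤ) {T : A} (hT : T ∈ e.localOn Γ) :
    e.siteSlice j T ∈ e.localOn (Γ.erase j) := by
  by_cases hj : j ∈ Γ
  · refine localOn_le (p := (e.localOn (Γ.erase j)).comap (e.siteSlice j).toLinearMap)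
      (fun σ τ => ?_) hT
    change e.siteSlice j _ ∈ e.localOn (Γ.erase j)
    have hu := unit_insert e (Finset.notMem_erase j Γ) σ τ
    rw [Finset.insert_erase hj] at hu
    rw [hu,
      siteSlice_mul_right (commutesAt_unit (Finset.notMem_erase j Γ) σ τ), siteSlice_site]
    split_ifs
    · rw [one_mul]; exact unit_mem_localOn _ _ _
    · rw [zero_mul]; exact zero_mem _
  · rw [Finset.erase_eq_of_notMem hj, siteSlice_eq_self (commutesAt_of_mem_localOn hj hT)]
    exact hT

variable (e) in
/-- The composition of the slice maps of the first `n` sites of a sequence. -/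
def sliceSeq (s : ℕ → ℤ) : ℕ → A →L[ℂ] A
  | 0 => ContinuousLinearMap.id ℂ _
  | n + 1 => (e.siteSlice (s n)).comp (sliceSeq s n)

lemma sliceSeq_succ (s : ℕ → ℤ) (n : ℕ) (T : A) :
    e.sliceSeq s (n + 1) T = e.siteSlice (s n) (e.sliceSeq s n T) := rfl

lemma norm_sliceSeq_le (s : ℕ → ℤ) (n : ℕ) (T : A) : ‖e.sliceSeq s n T‖ ≤ ‖T‖ := by
  induction n with
  | zero => exact le_rfl
  | succ n ih => exact (norm_siteSlice_le _ _).trans ih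

lemma sliceSeq_eq_self {s : ℕ → ℤ} {T : A} (h : ∀ n, e.CommutesAt (s n) T) (n : ℕ) :
    e.sliceSeq s n T = T := by
  induction n with
  | zero => rfl
  | succ n ih => rw [sliceSeq_succ, ih, siteSlice_eq_self (h n)]

lemma sliceSeq_mul_left {s : ℕ → ℤ} {S : A} (h : ∀ n, e.CommutesAt (s n) S) (T : A) (n : ℕ) :
    e.sliceSeq s n (S * T) = S * e.sliceSeq s n T := by
  induction n with
  | zero => rfl
  | succ n ih => rw [sliceSeq_succ, ih, siteSlice_mul_left (h n), sliceSeq_succ]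

lemma sliceSeq_mul_right {s : ℕ → ℤ} {S : A} (h : ∀ n, e.CommutesAt (s n) S) (T : A) (n : ℕ) :
    e.sliceSeq s n (T * S) = e.sliceSeq s n T * S := by
  induction n with
  | zero => rfl
  | succ n ih => rw [sliceSeq_succ, ih, siteSlice_mul_right (h n), sliceSeq_succ]

lemma sliceSeq_mem_localOn (s : ℕ → ℤ) {Γ : Finset ℤ} {T : A} (hT : T ∈ e.localOn Γ) (n : ℕ) :
    e.sliceSeq s n T ∈ e.localOn (Γ \ (Finset.range n).image s) := by
  induction n with
  | zero => simpa [sliceSeq] using hT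
  | succ n ih =>
    rw [sliceSeq_succ, Finset.range_add_one, Finset.image_insert, Finset.sdiff_insert]
    exact siteSlice_mem_localOn _ ih

/-- On a local observable, the compositions of slice maps are eventually constant. -/
lemma exists_sliceSeq_eq (s : ℕ → ℤ) {Γ : Finset ℤ} {T : A} (hT : T ∈ e.localOn Γ) :
    ∃ N, (∀ j ∈ Γ \ (Finset.range N).image s, j ∉ Set.range s) ∧
      ∀ n, N ≤ n → e.sliceSeq s n T = e.sliceSeq s N T := by
  -- `k j` is a time at which `s` visits `j`; the value at unvisited sites is arbitrary. After the
  -- largest `k j` with `j ∈ Γ`, every site of `Γ` that is ever visited has been sliced.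
  have h₁ : ∀ j : ℤ, ∃ k, j ∈ Set.range s → s k = j := fun j => by
    by_cases h : j ∈ Set.range s
    · exact ⟨h.choose, fun _ => h.choose_spec⟩
    · exact ⟨0, fun h' => absurd h' h⟩
  choose k hk using h₁
  have hN : ∀ j ∈ Γ \ (Finset.range (Γ.sup k + 1)).image s, j ∉ Set.range s := by
    intro j hj hjs
    rw [Finset.mem_sdiff] at hj
    exact hj.2 (Finset.mem_image.mpr
      ⟨k j, Finset.mem_range.mpr (Nat.lt_succ_of_le (Finset.le_sup hj.1)), hk j hjs⟩)
  refine ⟨Γ.sup k + 1, hN, fun n hn => ?_⟩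
  induction n, hn using Nat.le_induction with
  | base => rfl
  | succ n _ ih =>
    rw [sliceSeq_succ, ih, siteSlice_eq_self]
    exact commutesAt_of_mem_localOn (fun h => hN _ h ⟨n, rfl⟩) (sliceSeq_mem_localOn s hT _)

/-- The slices are contractions and stabilize on the dense set of local observables. -/
lemma cauchySeq_sliceSeq (s : ℕ → ℤ) (T : A) : CauchySeq fun n => e.sliceSeq s n T := by
  rw [Metric.cauchySeq_iff']
  intro ε hε
  obtain ⟨Γ, T', hT', h⟩ := e.exists_norm_sub_lt T (half_pos hε)
  obtain ⟨N, -, hN⟩ := exists_sliceSeq_eq (e := e) s hT'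
  refine ⟨N, fun n hn => ?_⟩
  have h₁ : ∀ m, ‖e.sliceSeq s m T - e.sliceSeq s m T'‖ < ε / 2 := fun m => by
    rw [← map_sub]; exact (norm_sliceSeq_le s m _).trans_lt h
  have h₂ : e.sliceSeq s n T - e.sliceSeq s N T =
      (e.sliceSeq s n T - e.sliceSeq s n T') - (e.sliceSeq s N T - e.sliceSeq s N T') := by
    rw [hN n hn]; abel
  rw [dist_eq_norm, h₂]
  linarith [norm_sub_le (e.sliceSeq s n T - e.sliceSeq s n T')
    (e.sliceSeq s N T - e.sliceSeq s N T'), h₁ n, h₁ N]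

variable (e) in
/-- There is a slice map onto the observables supported off a nonempty set of sites. -/
lemma exists_slice {S : Set ℤ} (hS : S.Nonempty) :
    ∃ E : A →L[ℂ] A, (∀ T, E T ∈ e.quasiOn Sᶜ) ∧
      (∀ T, (∀ j ∈ S, e.CommutesAt j T) → E T = T) ∧
      (∀ R T, (∀ j ∈ S, e.CommutesAt j R) → E (R * T) = R * E T) ∧
      ∀ R T, (∀ j ∈ S, e.CommutesAt j R) → E (T * R) = E T * R := by
  -- The enumeration may repeat sites: slicing a site twice has the same effect as slicing it once.
  obtain ⟨s, rfl⟩ := S.to_countable.exists_eq_range hS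
  simp only [Set.forall_mem_range]
  choose L hL using fun T => cauchySeq_tendsto_of_complete (cauchySeq_sliceSeq (e := e) s T)
  let E₀ : A →ₗ[ℂ] A :=
    { toFun := L
      map_add' := fun S T => tendsto_nhds_unique (hL (S + T))
        (by simpa only [map_add] using (hL S).add (hL T))
      map_smul' := fun c T => tendsto_nhds_unique (hL (c • T))
        (by simpa only [map_smul, RingHom.id_apply] using (hL T).const_smul c) }
  let E : A →L[ℂ] A := E₀.mkContinuous 1 fun T => by
    rw [one_mul]
    exact le_of_tendsto (hL T).norm (Filter.Eventually.of_forall fun n => norm_sliceSeq_le s n T)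
  have hE : ∀ T, Filter.Tendsto (fun n => e.sliceSeq s n T) Filter.atTop (𝓝 (E T)) := hL
  refine ⟨E, fun T => ?_, fun T hT => ?_, fun S T hS => ?_, fun S T hS => ?_⟩
  · refine quasiOn_subset (C := E ⁻¹' e.quasiOn (Set.range s)ᶜ)
      (isClosed_closure.preimage E.continuous) (fun Γ _ T hT => ?_) (e.mem_quasiOn_univ T)
    obtain ⟨N, hN, h⟩ := exists_sliceSeq_eq s hT
    have h₁ : E T = e.sliceSeq s N T := tendsto_nhds_unique (hE T)
      (tendsto_const_nhds.congr' (Filter.eventually_atTop.mpr ⟨N, fun n hn => (h n hn).symm⟩))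
    rw [Set.mem_preimage, h₁]
    exact mem_quasiOn_of_mem_localOn (fun j hj => hN j hj) (sliceSeq_mem_localOn s hT N)
  · exact tendsto_nhds_unique (hE T) (by simpa only [sliceSeq_eq_self hT] using tendsto_const_nhds)
  · exact tendsto_nhds_unique (hE (S * T))
      (by simpa only [sliceSeq_mul_left hS] using (hE T).const_mul S)
  · exact tendsto_nhds_unique (hE (T * S))
      (by simpa only [sliceSeq_mul_right hS] using (hE T).mul_const S)

/-- An observable that commutes with those on `S` is supported off `S`. -/
lemma mem_quasiOn_of_commutesAt {S : Set ℤ} (hS : S.Nonempty) {T : A}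
    (hT : ∀ j ∈ S, e.CommutesAt j T) : T ∈ e.quasiOn Sᶜ := by
  obtain ⟨E, h₁, h₂, -⟩ := e.exists_slice hS
  rw [← h₂ T hT]
  exact h₁ T

/-- The centre is trivial. -/
lemma exists_eq_smul_one {T : A} (hT : ∀ j, e.CommutesAt j T) : ∃ c : ℂ, T = c • (1 : A) := by
  have h := mem_quasiOn_of_commutesAt (S := Set.univ) ⟨0, trivial⟩ fun j _ => hT j
  have hC : IsClosed (Submodule.span ℂ {(1 : A)} : Set A) := Submodule.closed_of_finiteDimensional _
  have h₁ : T ∈ Submodule.span ℂ {(1 : A)} := by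
    -- The only finite set of sites off `univ` is empty, and its observables are the scalars.
    refine quasiOn_subset (S := Set.univᶜ) hC (fun Γ hΓ => localOn_le fun σ τ => ?_) h
    obtain rfl : Γ = ∅ := Finset.eq_empty_of_forall_notMem fun j hj => hΓ j hj trivial
    rw [e.unit_empty]
    exact Submodule.mem_span_singleton_self 1
  obtain ⟨c, hc⟩ := Submodule.mem_span_singleton.mp h₁
  exact ⟨c, hc.symm⟩

end MatrixUnits

end SpinChain

namespace SpinChain

namespace MatrixUnits

variable {d : ℕ} [NeZero d] {A : Type*} [CStarAlgebra A] {e : MatrixUnits d A}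

/-! ### Automorphisms -/

/-- A ⋆-automorphism as a continuous linear map. -/
def autCLM (δ : A ≃⋆ₐ[ℂ] A) : A →L[ℂ] A where
  toFun := δ
  map_add' := map_add δ
  map_smul' := map_smul δ
  cont := (StarAlgEquiv.isometry δ).continuous

/-- Every matrix unit is a product of one-site units, and these units span a dense subspace. -/
lemma aut_eq_of_site_eq {S : Set ℤ} {δ ε : A ≃⋆ₐ[ℂ] A}
    (h : ∀ j ∈ S, ∀ a b, δ (e.site j a b) = ε (e.site j a b)) {T : A} (hT : T ∈ e.quasiOn S) :
    δ T = ε T := by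
  refine clm_ext (φ := autCLM δ) (ψ := autCLM ε) (fun Γ hΓ σ τ => ?_) hT
  change δ _ = ε _
  induction Γ using Finset.induction_on with
  | empty => simp only [e.unit_empty, map_one]
  | insert j Γ hj ih =>
    rw [unit_insert _ hj, map_mul, map_mul, h j (hΓ j (Finset.mem_insert_self _ _)),
      ih fun i hi => hΓ i (Finset.mem_insert_of_mem hi)]

lemma aut_ext {δ ε : A ≃⋆ₐ[ℂ] A} (h : ∀ j a b, δ (e.site j a b) = ε (e.site j a b)) : δ = ε :=
  StarAlgEquiv.ext fun T => aut_eq_of_site_eq (S := Set.univ) (fun j _ => h j) (e.mem_quasiOn_univ T)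

variable (e) in
/-- The automorphisms that fix the observables supported on `S`. -/
def fixing (S : Set ℤ) : Subgroup (A ≃⋆ₐ[ℂ] A) where
  carrier := {δ | ∀ j ∈ S, ∀ a b, δ (e.site j a b) = e.site j a b}
  one_mem' _ _ _ _ := rfl
  mul_mem' {δ ε} hδ hε j hj a b := by
    change δ (ε _) = _
    rw [hε j hj, hδ j hj]
  inv_mem' {δ} hδ j hj a b := by
    change δ.symm _ = _
    rw [StarAlgEquiv.symm_apply_eq, hδ j hj]

lemma apply_eq_self_of_mem_fixing {S : Set ℤ} {δ : A ≃⋆ₐ[ℂ] A} (hδ : δ ∈ e.fixing S) {T : A}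
    (hT : T ∈ e.quasiOn S) : δ T = T :=
  aut_eq_of_site_eq (ε := 1) hδ hT

lemma commutesAt_apply {S : Set ℤ} {δ : A ≃⋆ₐ[ℂ] A} (hδ : δ ∈ e.fixing S) {j : ℤ} (hj : j ∈ S)
    {T : A} (hT : e.CommutesAt j T) : e.CommutesAt j (δ T) := fun a b => by
  have h := (hT a b).map δ
  rwa [hδ j hj] at h

lemma apply_site_mem_quasiOn {S : Set ℤ} (hS : S.Nonempty) {δ : A ≃⋆ₐ[ℂ] A} (hδ : δ ∈ e.fixing S)
    {j : ℤ} (hj : j ∉ S) (a b : Fin d) : δ (e.site j a b) ∈ e.quasiOn Sᶜ :=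
  mem_quasiOn_of_commutesAt hS fun _ hi => commutesAt_apply hδ hi
    (commutesAt_site (ne_of_mem_of_not_mem hi hj) a b)

lemma commute_of_mem_fixing {S : Set ℤ} (hS : S.Nonempty) (hS' : Sᶜ.Nonempty) {δ ε : A ≃⋆ₐ[ℂ] A}
    (hδ : δ ∈ e.fixing S) (hε : ε ∈ e.fixing Sᶜ) : Commute δ ε := by
  refine aut_ext (e := e) fun j a b => ?_
  change δ (ε _) = ε (δ _)
  by_cases hj : j ∈ S
  · rw [hδ j hj]
    have h := apply_site_mem_quasiOn hS' hε (Set.notMem_compl_iff.mpr hj) a b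
    rw [compl_compl] at h
    exact apply_eq_self_of_mem_fixing hδ h
  · rw [hε j hj]
    exact (apply_eq_self_of_mem_fixing hε (apply_site_mem_quasiOn hS hδ hj a b)).symm

/-- The scalars agree, since `u * star u * u` can be bracketed in two ways. Their common value is
real, and positive because it is the spectrum of `star u * u`; dividing `u` by its square root gives
a unitary. -/
lemma exists_unitary_smul {u : A} {c c' : ℂ} (hu : u ≠ 0) (h : star u * u = c • (1 : A))
    (h' : u * star u = c' • (1 : A)) : ∃ (r : ℂ) (v : unitary A), u = r • (v : A) ∧ r ≠ 0 := by
  have hA : Nontrivial A := ⟨⟨u, 0, hu⟩⟩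
  have hcc : c = c' := by
    refine smul_left_injective ℂ hu ?_
    change c • u = c' • u
    calc c • u = u * (star u * u) := by rw [h, mul_smul_comm, mul_one]
      _ = c' • u := by rw [← mul_assoc, h', smul_mul_assoc, one_mul]
  obtain ⟨x, rfl⟩ : ∃ x : ℝ, (x : ℂ) = c := by
    refine Complex.conj_eq_iff_real.mp ?_ |>.imp fun _ => Eq.symm
    have h₁ := congrArg star h
    rw [star_mul, star_star, star_smul, star_one, h] at h₁
    exact (smul_left_injective ℂ (one_ne_zero (α := A)) h₁).symm
  have h₁ : star u * u = algebraMap ℝ A x := by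
    rw [h, Algebra.algebraMap_eq_smul_one]
    exact Complex.coe_smul x 1
  have hx : 0 ≤ x := spectrum_star_mul_self_nonneg (b := u) x
    (by rw [h₁, spectrum.scalar_eq]; rfl)
  have hx' : x ≠ 0 := by
    rintro rfl
    rw [map_zero, CStarRing.star_mul_self_eq_zero_iff] at h₁
    exact hu h₁
  have hr : ((√x : ℝ) : ℂ) ≠ 0 := by
    exact_mod_cast (Real.sqrt_pos.mpr (lt_of_le_of_ne hx hx'.symm)).ne'
  have hrr : ((√x : ℝ) : ℂ)⁻¹ * (((√x : ℝ) : ℂ)⁻¹ * (x : ℂ)) = 1 := by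
    have : (x : ℂ) = (√x : ℝ) * (√x : ℝ) := by exact_mod_cast (Real.mul_self_sqrt hx).symm
    rw [this, inv_mul_cancel_left₀ hr, inv_mul_cancel₀ hr]
  have hst : star (((√x : ℝ) : ℂ)⁻¹ • u) = ((√x : ℝ) : ℂ)⁻¹ • star u := by
    rw [star_smul]
    congr 1
    rw [← Complex.ofReal_inv]
    exact Complex.conj_ofReal _
  refine ⟨(√x : ℝ), ⟨((√x : ℝ) : ℂ)⁻¹ • u, Unitary.mem_iff.mpr ⟨?_, ?_⟩⟩, ?_, hr⟩
  · rw [hst, smul_mul_assoc, mul_smul_comm, h, smul_smul, smul_smul, mul_assoc, hrr, one_smul]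
  · rw [hst, smul_mul_assoc, mul_smul_comm, h', ← hcc, smul_smul, smul_smul, mul_assoc, hrr, one_smul]
  · rw [smul_smul, mul_inv_cancel₀ hr, one_smul]

/-- If the product of an automorphism that fixes the observables on `S` and one that fixes those off
`S` is inner, then so are the two. -/
lemma exists_conjStarAlgAut_eq {S : Set ℤ} (hS : S.Nonempty) {δ ε : A ≃⋆ₐ[ℂ] A}
    (hδ : δ ∈ e.fixing S) (hε : ε ∈ e.fixing Sᶜ) {X : unitary A}
    (hX : Unitary.conjStarAlgAut ℂ A X = δ * ε) : ∃ u, Unitary.conjStarAlgAut ℂ A u = δ := by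
  rcases subsingleton_or_nontrivial A with hA | hA
  · exact ⟨1, StarAlgEquiv.ext fun _ => Subsingleton.elim _ _⟩
  obtain ⟨E, hE₁, hE₂, hE₃, hE₄⟩ := e.exists_slice hS
  -- Off `S` the automorphism `ε` is trivial, so `X` intertwines the identity with `δ` there.
  have hXa : ∀ j ∉ S, ∀ a b, (X : A) * e.site j a b = δ (e.site j a b) * X := by
    intro j hj a b
    have h := congrArg (fun φ : A ≃⋆ₐ[ℂ] A => φ (e.site j a b) * (X : A)) hX
    change (X : A) * e.site j a b * star (X : A) * X = δ (ε (e.site j a b)) * X at h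
    rw [hε j hj] at h
    rwa [mul_assoc, Unitary.star_mul_self_of_mem X.2, mul_one] at h
  -- The slice of `X` itself may vanish, so `X` is first multiplied by a matrix unit on `S`. If all
  -- these slices vanished, then so would `E (X * T)` for every `T`, since the part of a matrix unit
  -- off `S` comes out of `E`; but `T = star X` gives `E 1 = 1`.
  obtain ⟨Γ, hΓ, σ, τ, hu₀⟩ : ∃ Γ : Finset ℤ, (∀ j ∈ Γ, j ∈ S) ∧ ∃ σ τ,
      E (X * e.unit Γ σ τ) ≠ 0 := by
    by_contra! h
    have h₁ : ∀ T, (E.comp (ContinuousLinearMap.mul ℂ A (X : A))) T = (0 : A →L[ℂ] A) T := by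
      refine fun T => clm_ext (fun Γ _ σ τ => ?_) (e.mem_quasiOn_univ T)
      classical
      change E (X * e.unit Γ σ τ) = 0
      have h₂ := e.unit_mul_of_disjoint
        (Finset.disjoint_filter_filter_not Γ Γ fun j => j ∈ S) σ τ
      rw [Finset.filter_union_filter_not_eq] at h₂
      have h₃ : ∀ j ∈ S, e.CommutesAt j (e.unit (Γ.filter (· ∉ S)) σ τ) := fun j hj =>
        commutesAt_unit (by simp [hj]) σ τ
      rw [← h₂, ← mul_assoc, hE₄ _ _ h₃, h _ (fun j hj => (Finset.mem_filter.mp hj).2), zero_mul]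
    have h₂ := h₁ (star (X : A))
    change E (X * star (X : A)) = 0 at h₂
    rw [Unitary.mul_star_self_of_mem X.2, hE₂ 1 fun j _ a b => Commute.one_right _] at h₂
    exact one_ne_zero h₂
  set u₀ := E (X * e.unit Γ σ τ)
  -- The intertwining survives the slice: the site unit and its image under `δ` both commute with
  -- the observables on `S`.
  have hu : ∀ j ∉ S, ∀ a b, u₀ * e.site j a b = δ (e.site j a b) * u₀ := by
    intro j hj a b
    have hc : ∀ i ∈ S, e.CommutesAt i (e.site j a b) := fun i hi =>
      commutesAt_site (ne_of_mem_of_not_mem hi hj) a b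
    rw [← hE₄ _ _ hc, mul_assoc, (commute_unit (fun i hi => hc i (hΓ i hi)) σ τ).eq, ← mul_assoc,
      hXa j hj, mul_assoc, hE₃ _ _ fun i hi => commutesAt_apply hδ hi (hc i hi)]
  have hu' : ∀ j ∈ S, e.CommutesAt j u₀ := fun j hj =>
    commutesAt_of_mem_quasiOn (Set.notMem_compl_iff.mpr hj) (hE₁ _)
  have hstar : ∀ j ∉ S, ∀ a b, star u₀ * δ (e.site j a b) = e.site j a b * star u₀ := by
    intro j hj a b
    have h := congrArg star (hu j hj b a)
    rw [star_mul u₀, star_mul _ u₀, ← map_star δ, star_site] at h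
    exact h.symm
  obtain ⟨c, hc⟩ : ∃ c : ℂ, star u₀ * u₀ = c • (1 : A) := by
    refine exists_eq_smul_one (e := e) fun j => ?_
    by_cases hj : j ∈ S
    · exact (hu' j hj).star.mul (hu' j hj)
    · intro a b
      change _ = _
      rw [mul_assoc, hu j hj, ← mul_assoc, ← mul_assoc, hstar j hj]
  obtain ⟨c', hc'⟩ : ∃ c : ℂ, u₀ * star u₀ = c • (1 : A) := by
    -- Off `S`, `u₀ * star u₀` commutes with the images under `δ` of the site units; pulling back by
    -- `δ` makes it central.
    obtain ⟨c, hc⟩ : ∃ c : ℂ, δ.symm (u₀ * star u₀) = c • (1 : A) := by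
      refine exists_eq_smul_one (e := e) fun j => ?_
      by_cases hj : j ∈ S
      · exact commutesAt_apply (inv_mem hδ) hj ((hu' j hj).mul (hu' j hj).star)
      · intro a b
        have h : Commute (δ (e.site j a b)) (u₀ * star u₀) := by
          change _ = _
          rw [mul_assoc, hstar j hj, ← mul_assoc, ← mul_assoc, hu j hj]
        have h' := h.map δ.symm
        rwa [StarAlgEquiv.symm_apply_apply] at h'
    refine ⟨c, ?_⟩
    rw [StarAlgEquiv.symm_apply_eq] at hc
    rw [hc, map_smul, map_one]
  obtain ⟨r, v, hv, hr⟩ := exists_unitary_smul hu₀ hc hc'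
  refine ⟨v, aut_ext (e := e) fun j a b => ?_⟩
  have hvv : (v : A) * e.site j a b = δ (e.site j a b) * v := by
    have h : u₀ * e.site j a b = δ (e.site j a b) * u₀ := by
      by_cases hj : j ∈ S
      · rw [hδ j hj, (hu' j hj a b).eq]
      · exact hu j hj a b
    rw [hv, smul_mul_assoc, mul_smul_comm] at h
    exact smul_right_injective A hr h
  rw [Unitary.conjStarAlgAut_apply, hvv, mul_assoc, Unitary.mul_star_self_of_mem v.2, mul_one]

/-! ### Automorphisms modulo inner ones -/

variable (A) in
/-- The group of inner automorphisms. -/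
def inner : Subgroup (A ≃⋆ₐ[ℂ] A) := (Unitary.conjStarAlgAut ℂ A).range

/-- The action of the automorphisms on the unitary elements. -/
def unitaryAct : (A ≃⋆ₐ[ℂ] A) →* MulAut (unitary A) where
  toFun δ :=
    { toFun := fun u => ⟨δ u, Unitary.map_mem δ u.2⟩
      invFun := fun u => ⟨δ.symm u, Unitary.map_mem δ.symm u.2⟩
      left_inv := fun u => Subtype.ext (δ.symm_apply_apply u)
      right_inv := fun u => Subtype.ext (δ.apply_symm_apply u)
      map_mul' := fun _ _ => Subtype.ext (map_mul δ _ _) }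
  map_one' := rfl
  map_mul' _ _ := rfl

lemma conj_conjStarAlgAut (δ : A ≃⋆ₐ[ℂ] A) (u : unitary A) :
    δ * Unitary.conjStarAlgAut ℂ A u * δ⁻¹ =
      Unitary.conjStarAlgAut ℂ A (unitaryAct δ u) := by
  ext T
  change δ ((u : A) * δ.symm T * star (u : A)) = δ u * T * star (δ u)
  rw [map_mul, map_mul, map_star, StarAlgEquiv.apply_symm_apply]

instance : (inner A).Normal where
  conj_mem := by
    rintro _ ⟨u, rfl⟩ δ
    exact ⟨_, (conj_conjStarAlgAut δ u).symm⟩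

/-- If `Ad U * δ = Ad W * ε`, then `δ * ε⁻¹ = Ad (U⁻¹ * W)` is an inner product of automorphisms
fixing complementary regions, so `δ` is inner. -/
lemma mem_inner_of_mem_sup {S : Set ℤ} (hS : S.Nonempty) {φ : A ≃⋆ₐ[ℂ] A}
    (h : φ ∈ inner A ⊔ e.fixing S) (h' : φ ∈ inner A ⊔ e.fixing Sᶜ) : φ ∈ inner A := by
  obtain ⟨_, ⟨U, rfl⟩, δ, hδ, rfl⟩ := Subgroup.mem_sup_of_normal_left.mp h
  obtain ⟨_, ⟨W, rfl⟩, ε, hε, hφ⟩ := Subgroup.mem_sup_of_normal_left.mp h'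
  obtain ⟨u, rfl⟩ := exists_conjStarAlgAut_eq hS hδ (inv_mem hε) (X := U⁻¹ * W)
    (by rw [map_mul, map_inv, inv_mul_eq_iff_eq_mul, ← mul_assoc, ← hφ, mul_inv_cancel_right])
  exact mul_mem ⟨U, rfl⟩ ⟨u, rfl⟩

lemma commutator_mem_inner {S : Set ℤ} (hS : S.Nonempty) (hS' : Sᶜ.Nonempty) {φ ψ : A ≃⋆ₐ[ℂ] A}
    (h : φ ∈ inner A ⊔ e.fixing S) (h' : ψ ∈ inner A ⊔ e.fixing Sᶜ) :
    Commute (QuotientGroup.mk' (inner A) φ) (QuotientGroup.mk' (inner A) ψ) := by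
  obtain ⟨_, hU, δ, hδ, rfl⟩ := Subgroup.mem_sup_of_normal_left.mp h
  obtain ⟨_, hW, ε, hε, rfl⟩ := Subgroup.mem_sup_of_normal_left.mp h'
  have hk : ∀ x ∈ inner A, QuotientGroup.mk' (inner A) x = 1 := fun x hx =>
    (QuotientGroup.eq_one_iff x).mpr hx
  rw [map_mul, map_mul, hk _ hU, hk _ hW, one_mul, one_mul]
  exact (commute_of_mem_fixing hS hS' hδ hε).map _

section Restriction

variable {G : Type*} [Group G] {S : Set ℤ} {α : G →* A ≃⋆ₐ[ℂ] A} {β β' : G → A ≃⋆ₐ[ℂ] A}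

variable (e S α β) in
/-- `β` restricts `α` to the complement of `S`, up to inner automorphisms. -/
def IsRestriction : Prop :=
  ∀ g, β g ∈ inner A ⊔ e.fixing S ∧ α g * (β g)⁻¹ ∈ inner A ⊔ e.fixing Sᶜ

lemma IsRestriction.exists_defect (hS : S.Nonempty) (hS' : Sᶜ.Nonempty)
    (h : e.IsRestriction S α β) (g k : G) :
    ∃ u, β g * β k * (β (g * k))⁻¹ = Unitary.conjStarAlgAut ℂ A u := by
  suffices hφ : β g * β k * (β (g * k))⁻¹ ∈ inner A from ⟨_, hφ.choose_spec.symm⟩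
  refine mem_inner_of_mem_sup hS (mul_mem (mul_mem (h g).1 (h k).1) (inv_mem (h (g * k)).1)) ?_
  set η : G → A ≃⋆ₐ[ℂ] A := fun g => α g * (β g)⁻¹ with hη
  have hα : ∀ g, α g = η g * β g := fun g => by simp [hη]
  set q := QuotientGroup.mk' (inner A) with hq
  -- Modulo inner automorphisms, `η g * β g * η k * β k = η (g * k) * β (g * k)`, and `β g` moves
  -- past `η k`.
  have hc : q (β g * β k * (β (g * k))⁻¹) = q ((η k)⁻¹ * (η g)⁻¹ * η (g * k)) := by
    have h₁ := congrArg q (map_mul α g k)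
    have h₂ := (commutator_mem_inner hS hS' (h g).1 (h k).2).eq
    change q _ * q (η k) = q (η k) * q _ at h₂
    rw [hα, hα, hα] at h₁
    simp only [map_mul, map_inv] at h₁ ⊢
    rw [mul_assoc, ← mul_assoc (q (β g)), h₂] at h₁
    rw [mul_inv_eq_iff_eq_mul, mul_assoc, h₁]
    simp only [mul_assoc, inv_mul_cancel_left]
  have hm : ((η k)⁻¹ * (η g)⁻¹ * η (g * k))⁻¹ * (β g * β k * (β (g * k))⁻¹) ∈ inner A := by
    rw [← QuotientGroup.eq]
    exact hc.symm
  rw [← mul_inv_cancel_left ((η k)⁻¹ * (η g)⁻¹ * η (g * k)) (β g * β k * (β (g * k))⁻¹)]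
  exact mul_mem (mul_mem (mul_mem (inv_mem (h k).2) (inv_mem (h g).2)) (h (g * k)).2)
    (Subgroup.mem_sup_left hm)

lemma IsRestriction.exists_eq_mul (hS : S.Nonempty) (h : e.IsRestriction S α β)
    (h' : e.IsRestriction S α β') (g : G) : ∃ u, β' g = Unitary.conjStarAlgAut ℂ A u * β g := by
  have hφ : β' g * (β g)⁻¹ ∈ inner A := by
    refine mem_inner_of_mem_sup hS (mul_mem (h' g).1 (inv_mem (h g).1)) ?_
    -- Cancelling `α g` exhibits the quotient as a product of automorphisms of the other type.
    have : β' g * (β g)⁻¹ = (α g * (β' g)⁻¹)⁻¹ * (α g * (β g)⁻¹) := by group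
    rw [this]
    exact mul_mem (inv_mem (h' g).2) (h g).2
  obtain ⟨u, hu⟩ := hφ
  exact ⟨u, by rw [hu, inv_mul_cancel_right]⟩

end Restriction

variable (e) in
/-- The crossed module of the unitary elements and the automorphisms. -/
def crossedModule [Nontrivial A] :
    TrivialKernelCrossedModule (unitary A) (A ≃⋆ₐ[ℂ] A) Circle where
  bd := Unitary.conjStarAlgAut ℂ A
  act := unitaryAct
  ι :=
    { toFun := fun z => ⟨(z : ℂ) • (1 : A), Unitary.mem_iff.mpr (by
        have h : star (z : ℂ) * z = 1 := by
          rw [← show ((z⁻¹ : Circle) : ℂ) = star (z : ℂ) from Circle.coe_inv_eq_conj z,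
            ← Circle.coe_mul, inv_mul_cancel, Circle.coe_one]
        constructor
        · rw [star_smul, star_one, smul_mul_smul_comm, h, one_mul, one_smul]
        · rw [star_smul, star_one, smul_mul_smul_comm, mul_comm, h, one_mul, one_smul])⟩
      map_one' := Subtype.ext (by simp)
      map_mul' := fun z w => Subtype.ext (by simp [smul_smul, mul_comm]) }
  bd_act δ u := (conj_conjStarAlgAut δ u).symm
  act_bd _ _ := rfl
  ι_injective z w h := Circle.ext
    (smul_left_injective ℂ (one_ne_zero (α := A)) (congrArg Subtype.val h))
  exists_of_bd_eq_one u hu := by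
    have hc : ∀ T, Commute T (u : A) := fun T => by
      have h : (u : A) * T * star (u : A) = T := congrArg (fun φ : A ≃⋆ₐ[ℂ] A => φ T) hu
      have h' := congrArg (· * (u : A)) h
      simp only [mul_assoc, Unitary.star_mul_self_of_mem u.2, mul_one] at h'
      exact h'.symm
    obtain ⟨c, hc⟩ := exists_eq_smul_one (e := e) (T := u) fun j a b => hc _
    have h₁ : ‖c‖ = 1 := by
      have := CStarRing.norm_of_mem_unitary u.2
      rwa [hc, norm_smul, norm_one, mul_one] at this
    exact ⟨⟨c, mem_sphere_zero_iff_norm.mpr h₁⟩, Subtype.ext hc⟩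
  bd_ι z := by
    ext T
    change (z : ℂ) • (1 : A) * T * star ((z : ℂ) • (1 : A)) = T
    have h : (z : ℂ) * star (z : ℂ) = 1 := by
      rw [← show ((z⁻¹ : Circle) : ℂ) = star (z : ℂ) from Circle.coe_inv_eq_conj z,
        ← Circle.coe_mul, mul_inv_cancel, Circle.coe_one]
    rw [star_smul, star_one, smul_mul_assoc, one_mul, smul_mul_smul_comm, h, mul_one, one_smul]
  act_ι δ z := Subtype.ext (by
    change δ ((z : ℂ) • (1 : A)) = (z : ℂ) • (1 : A)
    rw [map_smul, map_one])

end MatrixUnits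

end SpinChain

/-! ### Contractivity of unital maps in Kraus form -/

/-- This gives the norm bound for one-site slices, with `W a` the matrix unit `e_{0a}`. The
hypothesis on `W` says that `f ↦ (W i f)` is isometric into a direct sum; Cauchy–Schwarz then bounds
`‖v‖ ^ 2` for `v` in the range by `‖T‖ * ‖f‖ * ‖v‖`. -/
lemma ContinuousLinearMap.norm_sum_star_mul_mul_le {H ι : Type*} [NormedAddCommGroup H]
    [InnerProductSpace ℂ H] [CompleteSpace H] (s : Finset ι) (W : ι → H →L[ℂ] H)
    (hW : ∑ i ∈ s, star (W i) * W i = 1) (T : H →L[ℂ] H) :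
    ‖∑ i ∈ s, star (W i) * T * W i‖ ≤ ‖T‖ := by
  have hinner : ∀ f g : H, ∀ R : H →L[ℂ] H, inner ℂ g ((∑ i ∈ s, star (W i) * R * W i) f) =
      ∑ i ∈ s, inner ℂ (W i g) (R (W i f)) := by
    intro f g R
    rw [_root_.sum_apply, inner_sum]
    refine Finset.sum_congr rfl fun i _ => ?_
    rw [ContinuousLinearMap.star_eq_adjoint]
    exact ContinuousLinearMap.adjoint_inner_right _ _ _
  have hsq : ∀ f : H, ∑ i ∈ s, ‖W i f‖ ^ 2 = ‖f‖ ^ 2 := by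
    intro f
    have h := hinner f f 1
    simp only [mul_one, hW, one_apply_eq_self, inner_self_eq_norm_sq_to_K] at h
    exact_mod_cast h.symm
  refine ContinuousLinearMap.opNorm_le_bound _ (norm_nonneg _) fun f => ?_
  set v := (∑ i ∈ s, star (W i) * T * W i) f with hv
  have h : ‖v‖ ^ 2 ≤ ‖T‖ * ‖f‖ * ‖v‖ := by
    calc ‖v‖ ^ 2 = ‖inner ℂ v v‖ := by
          rw [inner_self_eq_norm_sq_to_K]; simp
      _ = ‖∑ i ∈ s, inner ℂ (W i v) (T (W i f))‖ := by rw [← hinner]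
      _ ≤ ∑ i ∈ s, ‖T‖ * (‖W i f‖ * ‖W i v‖) := by
          refine norm_sum_le_of_le _ fun i _ => ?_
          refine (norm_inner_le_norm _ _).trans ?_
          calc ‖W i v‖ * ‖T (W i f)‖ ≤ ‖W i v‖ * (‖T‖ * ‖W i f‖) := by
                gcongr; exact T.le_opNorm _
            _ = _ := by ring
      _ = ‖T‖ * ∑ i ∈ s, ‖W i f‖ * ‖W i v‖ := by rw [Finset.mul_sum]
      _ ≤ ‖T‖ * (√(∑ i ∈ s, ‖W i f‖ ^ 2) * √(∑ i ∈ s, ‖W i v‖ ^ 2)) := by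
          gcongr; exact Real.sum_mul_le_sqrt_mul_sqrt _ _ _
      _ = ‖T‖ * ‖f‖ * ‖v‖ := by
          rw [hsq, hsq, Real.sqrt_sq (norm_nonneg _), Real.sqrt_sq (norm_nonneg _), mul_assoc]
  rcases (norm_nonneg v).eq_or_lt with h0 | h0
  · rw [← h0]; positivity
  · rw [pow_two] at h
    exact le_of_mul_le_mul_right h h0

namespace SpinChain

variable {d : ℕ}

/-! ### Local observables -/

lemma range_localRep_mono {Γ Γ' : Finset ℤ} (h : Γ ⊆ Γ') :
    (localRep (d := d) Γ).range ≤ (localRep Γ').range := by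
  rintro _ ⟨M, rfl⟩
  exact ⟨extendMatrix h M, localRep_extendMatrix h M⟩

/-- The local algebras are directed under inclusion, so their union is already a subalgebra and
equals the supremum. -/
lemma mem_localAlgebra_iff {X : Set ℝ} {T : ConfigSpace d →L[ℂ] ConfigSpace d} :
    T ∈ localAlgebra d X ↔
      ∃ Γ : Finset ℤ, (∀ j ∈ Γ, (j : ℝ) ∈ X) ∧ T ∈ (localRep (d := d) Γ).range := by
  constructor
  · have hU : ∀ {Γ Γ' : Finset ℤ}, (∀ j ∈ Γ, (j : ℝ) ∈ X) → (∀ j ∈ Γ', (j : ℝ) ∈ X) →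
        ∀ j ∈ Γ ∪ Γ', (j : ℝ) ∈ X := fun h h' j hj => (Finset.mem_union.mp hj).elim (h j) (h' j)
    let S : StarSubalgebra ℂ (ConfigSpace d →L[ℂ] ConfigSpace d) :=
      { carrier := {T | ∃ Γ : Finset ℤ, (∀ j ∈ Γ, (j : ℝ) ∈ X) ∧ T ∈ (localRep (d := d) Γ).range}
        mul_mem' := by
          rintro _ _ ⟨Γ, h, hT⟩ ⟨Γ', h', hT'⟩
          exact ⟨Γ ∪ Γ', hU h h', mul_mem (range_localRep_mono Finset.subset_union_left hT)
            (range_localRep_mono Finset.subset_union_right hT')⟩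
        add_mem' := by
          rintro _ _ ⟨Γ, h, hT⟩ ⟨Γ', h', hT'⟩
          exact ⟨Γ ∪ Γ', hU h h', add_mem (range_localRep_mono Finset.subset_union_left hT)
            (range_localRep_mono Finset.subset_union_right hT')⟩
        algebraMap_mem' := fun r => ⟨∅, by simp, algebraMap_mem _ r⟩
        star_mem' := by
          rintro _ ⟨Γ, h, hT⟩
          exact ⟨Γ, h, star_mem hT⟩ }
    have hS : localAlgebra d X ≤ S := iSup_le fun Γ T hT => ⟨Γ.1, Γ.2, hT⟩
    exact fun hT => hS hT
  · rintro ⟨Γ, h, hT⟩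
    exact le_iSup (fun Γ : {Γ : Finset ℤ // ∀ j ∈ Γ, (j : ℝ) ∈ X} => (localRep Γ.1).range)
      ⟨Γ, h⟩ hT

/-- The observables supported on the finite set `Γ`, inside the quasi-local algebra. -/
def localOn (d : ℕ) (Γ : Finset ℤ) : StarSubalgebra ℂ (QuasiLocal d) :=
  (localRep Γ).range.comap (localAlgebra d Set.univ).topologicalClosure.subtype

lemma range_localRep_le (Γ : Finset ℤ) :
    (localRep (d := d) Γ).range ≤ (localAlgebra d Set.univ).topologicalClosure :=
  fun _ hT => StarSubalgebra.le_topologicalClosure _ (mem_localAlgebra_iff.mpr ⟨Γ, by simp, hT⟩)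

lemma mem_quasiLocalOn {X : Set ℝ} {T : QuasiLocal d} :
    T ∈ quasiLocalOn d X ↔
      (T : ConfigSpace d →L[ℂ] ConfigSpace d) ∈ (localAlgebra d X).topologicalClosure :=
  Iff.rfl

lemma localOn_le_quasiLocalOn {Γ : Finset ℤ} {X : Set ℝ} (h : ∀ j ∈ Γ, (j : ℝ) ∈ X) :
    localOn d Γ ≤ quasiLocalOn d X :=
  fun _ hT => StarSubalgebra.le_topologicalClosure _ (mem_localAlgebra_iff.mpr ⟨Γ, h, hT⟩)

lemma mem_quasiLocalOn_univ (T : QuasiLocal d) : T ∈ quasiLocalOn d Set.univ := T.2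

lemma exists_localOn_norm_sub_lt {X : Set ℝ} {T : QuasiLocal d} (hT : T ∈ quasiLocalOn d X)
    {ε : ℝ} (hε : 0 < ε) :
    ∃ Γ : Finset ℤ, (∀ j ∈ Γ, (j : ℝ) ∈ X) ∧ ∃ T' ∈ localOn d Γ, ‖T - T'‖ < ε := by
  obtain ⟨T', hT', h⟩ := Metric.mem_closure_iff.mp (mem_quasiLocalOn.mp hT) ε hε
  obtain ⟨Γ, hΓ, hT''⟩ := mem_localAlgebra_iff.mp hT'
  exact ⟨Γ, hΓ, ⟨T', range_localRep_le Γ hT''⟩, hT'', by rwa [dist_eq_norm] at h⟩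

/-! ### Matrix units -/

lemma matrixUnit_mem_range (Γ : Finset ℤ) (a b : Γ → Fin d) :
    matrixUnit Γ a b ∈ (localRep (d := d) Γ).range := by
  refine ⟨Matrix.of fun a' b' => if a' = a ∧ b' = b then 1 else 0, ?_⟩
  change localOp _ _ = _
  rw [localOp, Finset.sum_eq_single a, Finset.sum_eq_single b]
  · simp
  · intro b' _ hb; simp [hb]
  · simp
  · intro a' _ ha
    exact Finset.sum_eq_zero fun b' _ => by simp [ha]
  · simp

/-- The matrix unit of `⨂_{j ∈ Γ} B(V)` whose indices are the restrictions of `σ` and `τ`. -/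
def chainUnit (Γ : Finset ℤ) (σ τ : Config d) : QuasiLocal d :=
  ⟨matrixUnit Γ (restrict Γ σ) (restrict Γ τ), range_localRep_le Γ (matrixUnit_mem_range Γ _ _)⟩

lemma restrict_eq_iff {Γ : Finset ℤ} {ρ σ : Config d} :
    restrict Γ ρ = restrict Γ σ ↔ ∀ i ∈ Γ, ρ i = σ i := by
  simp [funext_iff, restrict]

lemma override_restrict_eq (Γ : Finset ℤ) (ρ τ : Config d) :
    override Γ ρ (restrict Γ τ) = fun i => if i ∈ Γ then τ i else ρ i := by
  funext i; simp [override, restrict]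

lemma chainUnit_apply (Γ : Finset ℤ) (σ τ : Config d) (f : ConfigSpace d) (ρ : Config d) :
    (chainUnit Γ σ τ : ConfigSpace d →L[ℂ] ConfigSpace d) f ρ =
      if ∀ i ∈ Γ, ρ i = σ i then f (fun i => if i ∈ Γ then τ i else ρ i) else 0 := by
  change matrixUnit Γ _ _ f ρ = _
  simp only [matrixUnit_apply, restrict_eq_iff, override_restrict_eq]

lemma ext_apply {S T : QuasiLocal d}
    (h : ∀ f ρ, (S : ConfigSpace d →L[ℂ] ConfigSpace d) f ρ =
      (T : ConfigSpace d →L[ℂ] ConfigSpace d) f ρ) : S = T := by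
  ext f ρ
  exact h f ρ

lemma mul_apply' (S T : QuasiLocal d) (f : ConfigSpace d) :
    ((S * T : QuasiLocal d) : ConfigSpace d →L[ℂ] ConfigSpace d) f =
      (S : ConfigSpace d →L[ℂ] ConfigSpace d) ((T : ConfigSpace d →L[ℂ] ConfigSpace d) f) := rfl

lemma chainUnit_congr {Γ : Finset ℤ} {σ σ' τ τ' : Config d} (h : ∀ i ∈ Γ, σ i = σ' i)
    (h' : ∀ i ∈ Γ, τ i = τ' i) : chainUnit Γ σ τ = chainUnit Γ σ' τ' := by
  unfold chainUnit
  congr 2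
  · exact restrict_eq_iff.mpr h
  · exact restrict_eq_iff.mpr h'

lemma chainUnit_empty (σ τ : Config d) : chainUnit ∅ σ τ = 1 := by
  refine ext_apply fun f ρ => ?_
  rw [chainUnit_apply]
  simp

lemma chainUnit_mul_of_disjoint {Γ Γ' : Finset ℤ} (h : Disjoint Γ Γ') (σ τ : Config d) :
    chainUnit Γ σ τ * chainUnit Γ' σ τ = chainUnit (Γ ∪ Γ') σ τ := by
  refine ext_apply fun f ρ => ?_
  rw [mul_apply', chainUnit_apply, chainUnit_apply, chainUnit_apply]
  have h₁ : ∀ i ∈ Γ', i ∉ Γ := fun i hi hi' => Finset.disjoint_left.mp h hi' hi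
  by_cases ha : ∀ i ∈ Γ, ρ i = σ i
  · by_cases hb : ∀ i ∈ Γ', ρ i = σ i
    · rw [if_pos ha, if_pos fun i hi => by rw [if_neg (h₁ i hi), hb i hi], if_pos]
      · refine congrArg (f : Config d → ℂ) (funext fun i => ?_)
        by_cases hi : i ∈ Γ <;> by_cases hi' : i ∈ Γ' <;> simp [hi, hi']
      · intro i hi
        exact (Finset.mem_union.mp hi).elim (ha i) (hb i)
    · rw [if_pos ha, if_neg, if_neg]
      · exact fun hc => hb fun i hi => hc i (Finset.mem_union_right _ hi)
      · refine fun hc => hb fun i hi => ?_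
        rw [← hc i hi, if_neg (h₁ i hi)]
  · rw [if_neg ha, if_neg]
    exact fun hc => ha fun i hi => hc i (Finset.mem_union_left _ hi)

lemma chainUnit_mul_same (Γ : Finset ℤ) (σ τ υ : Config d) :
    chainUnit Γ σ τ * chainUnit Γ τ υ = chainUnit Γ σ υ := by
  refine ext_apply fun f ρ => ?_
  rw [mul_apply', chainUnit_apply, chainUnit_apply, chainUnit_apply]
  congr 1
  rw [if_pos fun i hi => by rw [if_pos hi]]
  refine congrArg (f : Config d → ℂ) (funext fun i => ?_)
  by_cases hi : i ∈ Γ <;> simp [hi]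

lemma chainUnit_mul_of_ne {Γ : Finset ℤ} {σ τ τ' υ : Config d} {j : ℤ} (hj : j ∈ Γ)
    (h : τ j ≠ τ' j) : chainUnit Γ σ τ * chainUnit Γ τ' υ = 0 := by
  refine ext_apply fun f ρ => ?_
  rw [mul_apply', chainUnit_apply, chainUnit_apply,
    if_neg (c := ∀ i ∈ Γ, (if i ∈ Γ then τ i else ρ i) = τ' i)
      fun hc => h (by simpa [hj] using hc j hj)]
  exact ite_self _

lemma chainUnit_mem_localOn (Γ : Finset ℤ) (σ τ : Config d) : chainUnit Γ σ τ ∈ localOn d Γ :=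
  matrixUnit_mem_range Γ _ _

lemma star_chainUnit (Γ : Finset ℤ) (σ τ : Config d) :
    star (chainUnit Γ σ τ) = chainUnit Γ τ σ :=
  Subtype.ext (adjoint_matrixUnit _ _ _)

lemma sum_chainUnit (j : ℤ) : ∑ a : Fin d, chainUnit {j} (fun _ => a) (fun _ => a) = 1 := by
  refine ext_apply fun f ρ => ?_
  have h : ((∑ a : Fin d, chainUnit {j} (fun _ => a) (fun _ => a) : QuasiLocal d) :
      ConfigSpace d →L[ℂ] ConfigSpace d) f ρ =
      ∑ a : Fin d, (chainUnit {j} (fun _ => a) (fun _ => a) :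
        ConfigSpace d →L[ℂ] ConfigSpace d) f ρ := by
    rw [← Finset.sum_apply, ← lp.coeFn_sum, ← sum_apply, AddSubmonoidClass.coe_finsetSum]
  rw [h, Finset.sum_eq_single (ρ j)]
  · rw [chainUnit_congr (σ' := ρ) (τ' := ρ) (by simp) (by simp), chainUnit_apply]
    simp
  · intro a _ ha
    simp [chainUnit_apply, ha.symm]
  · simp

/-- Matrix units span the observables on a finite set. -/
lemma localOn_le_of_chainUnit_mem [NeZero d] {Γ : Finset ℤ} {S : Submodule ℂ (QuasiLocal d)}
    (h : ∀ σ τ, chainUnit Γ σ τ ∈ S) {T : QuasiLocal d} (hT : T ∈ localOn d Γ) : T ∈ S := by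
  obtain ⟨M, hM⟩ := hT
  have : T = ∑ a, ∑ b, M a b • chainUnit Γ (override Γ (fun _ => 0) a) (override Γ (fun _ => 0) b) := by
    apply Subtype.ext
    change _ = (localAlgebra d Set.univ).topologicalClosure.subtype _
    simp only [map_sum, map_smul]
    refine hM.symm.trans ?_
    change localOp Γ M = _
    simp [localOp, chainUnit]
  rw [this]
  exact sum_mem fun a _ => sum_mem fun b _ => S.smul_mem _ (h _ _)

lemma norm_sum_chainUnit_mul_mul_le [NeZero d] (j : ℤ) (T : QuasiLocal d) :
    ‖∑ a : Fin d, chainUnit {j} (fun _ => a) (fun _ => 0) * T *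
      chainUnit {j} (fun _ => 0) (fun _ => a)‖ ≤ ‖T‖ := by
  have h₁ : ∑ a : Fin d, star (chainUnit {j} (fun _ => 0) (fun _ => a) :
      ConfigSpace d →L[ℂ] ConfigSpace d) * (chainUnit {j} (fun _ => 0) (fun _ => a) :
      ConfigSpace d →L[ℂ] ConfigSpace d) = 1 := by
    have h := congrArg (Subtype.val : QuasiLocal d → _) (sum_chainUnit (d := d) j)
    rw [AddSubmonoidClass.coe_finsetSum] at h
    refine (Finset.sum_congr rfl fun a _ => ?_).trans h
    rw [← chainUnit_mul_same {j} (fun _ => a) (fun _ => 0),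
      ← star_chainUnit {j} (fun _ => 0) fun _ => a]
    rfl
  refine le_of_eq_of_le ?_ (ContinuousLinearMap.norm_sum_star_mul_mul_le Finset.univ _ h₁ T)
  change ‖((_ : QuasiLocal d) : ConfigSpace d →L[ℂ] ConfigSpace d)‖ = _
  rw [AddSubmonoidClass.coe_finsetSum]
  refine congrArg norm (Finset.sum_congr rfl fun a _ => ?_)
  rw [← star_chainUnit {j} (fun _ => 0) fun _ => a]
  rfl

instance : CStarAlgebra (QuasiLocal d) :=
  StarSubalgebra.cstarAlgebra _ (h_closed := StarSubalgebra.isClosed_topologicalClosure _)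

instance [NeZero d] : Nontrivial (QuasiLocal d) := by
  refine ⟨⟨1, 0, fun h => ?_⟩⟩
  have h₁ : (1 : ConfigSpace d →L[ℂ] ConfigSpace d) = 0 := congrArg Subtype.val h
  have h₂ := localRep_injective (d := d) ∅ (a₁ := 1) (a₂ := 0) (by rw [map_one, map_zero, h₁])
  exact one_ne_zero h₂

lemma exists_span_norm_sub_lt [NeZero d] (T : QuasiLocal d) {ε : ℝ} (hε : 0 < ε) :
    ∃ Γ, ∃ T' ∈ Submodule.span ℂ (Set.range fun p : Config d × Config d => chainUnit Γ p.1 p.2),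
      ‖T - T'‖ < ε := by
  obtain ⟨Γ, -, T', hT', h⟩ := exists_localOn_norm_sub_lt (mem_quasiLocalOn_univ T) hε
  refine ⟨Γ, T', ?_, h⟩
  exact localOn_le_of_chainUnit_mem
    (S := Submodule.span ℂ (Set.range fun p : Config d × Config d => chainUnit Γ p.1 p.2))
    (fun σ τ => Submodule.subset_span ⟨(σ, τ), rfl⟩) hT'

variable (d) in
/-- The matrix units of the quasi-local algebra. -/
def chainUnits [NeZero d] : MatrixUnits d (QuasiLocal d) where
  unit := chainUnit
  unit_congr := chainUnit_congr
  unit_empty := chainUnit_empty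
  unit_mul_of_disjoint := chainUnit_mul_of_disjoint
  unit_mul_same := chainUnit_mul_same
  unit_mul_of_ne := chainUnit_mul_of_ne
  star_unit := star_chainUnit
  sum_unit := sum_chainUnit
  norm_sum_unit_mul_mul_le := norm_sum_chainUnit_mul_mul_le
  exists_norm_sub_lt T _ hε := exists_span_norm_sub_lt T hε

end SpinChain

namespace SpinChain

variable {d : ℕ} [NeZero d]

/-! ### The anomaly of a symmetry action -/

lemma chainUnits_site_mem {X : Set ℝ} {j : ℤ} (hj : (j : ℝ) ∈ X) (a b : Fin d) :
    (chainUnits d).site j a b ∈ quasiLocalOn d X :=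
  localOn_le_quasiLocalOn (Γ := {j}) (by simpa using hj) (chainUnit_mem_localOn _ _ _)

/-- The sites of the left half-chain. -/
def leftSites : Set ℤ := {j | j < 0}

lemma leftSites_nonempty : leftSites.Nonempty := ⟨-1, by simp [leftSites]⟩

lemma compl_leftSites_nonempty : leftSitesᶜ.Nonempty := ⟨0, by simp [leftSites]⟩

lemma rightLPA_subset {γ : ChainAut d} (h : γ ∈ rightLPA d) :
    γ ∈ MatrixUnits.inner (QuasiLocal d) ⊔ (chainUnits d).fixing leftSites := by
  obtain ⟨U, δ, ⟨-, -, hδ⟩, rfl⟩ := h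
  refine Subgroup.mul_mem_sup ⟨U, rfl⟩ fun j hj a b => hδ _ (chainUnits_site_mem ?_ a b)
  exact Int.cast_lt_zero (R := ℝ).mpr hj

lemma leftLPA_subset {γ : ChainAut d} (h : γ ∈ leftLPA d) :
    γ ∈ MatrixUnits.inner (QuasiLocal d) ⊔ (chainUnits d).fixing leftSitesᶜ := by
  obtain ⟨U, δ, ⟨-, -, hδ⟩, rfl⟩ := h
  refine Subgroup.mul_mem_sup ⟨U, rfl⟩ fun j hj a b => hδ _ (chainUnits_site_mem ?_ a b)
  exact Int.cast_nonneg (R := ℝ) (not_lt.mp hj)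

section

variable {G : Type*} [Group G] {α : G →* ChainAut d} {β β' : G → ChainAut d}
  {V V' : G → G → unitary (QuasiLocal d)}

lemma IsHalfChainRestriction.isRestriction (h : IsHalfChainRestriction α β) :
    (chainUnits d).IsRestriction leftSites α β :=
  fun g => ⟨rightLPA_subset (h g).1, leftLPA_subset (h g).2⟩

lemma IsDefect.isLift (h : IsDefect β V) : (chainUnits d).crossedModule.IsLift β V := h

lemma anomalyOp_eq {w : G → G → G → Circle}
    (h : (chainUnits d).crossedModule.IsObstruction β V w) (a b c : G) :
    anomalyOp β V a b c = toPhase (threeCochain w ![a, b, c]) • (1 : QuasiLocal d) := by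
  have h₁ : V a b * V (a * b) c * (V a (b * c))⁻¹ *
      ((chainUnits d).crossedModule.act (β a) (V b c))⁻¹ =
        (chainUnits d).crossedModule.ι (w a b c) := by
    rw [h a b c]
    group
  -- In the unitary group the inverse is `star`, so the underlying elements match by definition.
  exact congrArg Subtype.val h₁

end

end SpinChain
end

theorem mainTheorem5 {d : ℕ} [NeZero d] {G : Type*} [Group G]
    (α : G →* SpinChain.ChainAut d)
    (hα : ∀ g, SpinChain.IsLPA (α g))
    (hα₀ : ∀ g, SpinChain.HasGNVWIndex (α g) 0) :
    (∀ β : G → SpinChain.ChainAut d, SpinChain.IsHalfChainRestriction α β →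
      ∃ V : G → G → unitary (SpinChain.QuasiLocal d), SpinChain.IsDefect β V) ∧
    ∃ c : groupCohomology (SpinChain.trivialU1 G) 3,
      ∀ (β : G → SpinChain.ChainAut d) (V : G → G → unitary (SpinChain.QuasiLocal d)),
        SpinChain.IsHalfChainRestriction α β → SpinChain.IsDefect β V →
          ∃ (ω : (Fin 3 → G) → SpinChain.trivialU1 G)
            (hω : inhomogeneousCochains.d (SpinChain.trivialU1 G) 3 ω = 0),
            (∀ g₁ g₂ g₃ : G, SpinChain.anomalyOp β V g₁ g₂ g₃ =
              SpinChain.toPhase (ω ![g₁, g₂, g₃]) • (1 : SpinChain.QuasiLocal d)) ∧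
            groupCohomology.π (SpinChain.trivialU1 G) 3 (groupCohomology.cocyclesMk ω hω) = c := by
  open SpinChain in
  constructor
  · intro β hβ
    choose V hV using hβ.isRestriction.exists_defect leftSites_nonempty compl_leftSites_nonempty
    exact ⟨V, hV⟩
  -- The class must be chosen before `β` and `V`: take that of a reference pair. If there is no such
  -- pair, any class will do.
  by_cases hex : ∃ (β : G → ChainAut d) (V : G → G → unitary (QuasiLocal d)),
      IsHalfChainRestriction α β ∧ IsDefect β V
  · obtain ⟨β₀, V₀, hβ₀, hV₀⟩ := hex
    obtain ⟨w₀, hw₀⟩ := hV₀.isLift.exists_isObstruction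
    refine ⟨groupCohomology.π (trivialU1 G) 3 (groupCohomology.cocyclesMk (threeCochain w₀)
      (d_threeCochain_eq_zero (hw₀.cocycle hV₀.isLift))), fun β V hβ hV => ?_⟩
    obtain ⟨w, hw⟩ := hV.isLift.exists_isObstruction
    refine ⟨threeCochain w, d_threeCochain_eq_zero (hw.cocycle hV.isLift), anomalyOp_eq hw, ?_⟩
    obtain ⟨m, hm⟩ := hw.exists_coboundary hV.isLift hw₀ hV₀.isLift
      (hβ.isRestriction.exists_eq_mul leftSites_nonempty hβ₀.isRestriction)
    exact groupCohomology.π_cocyclesMk_eq _ _ _ _ (twoCochain m) (d_twoCochain_eq hm)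
  · exact ⟨0, fun β V hβ hV => (hex ⟨β, V, hβ, hV⟩).elim⟩
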